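/- Let $k$ be a commutative ring and let $H$ be a Hopf algebra over $k$ with invertible antipode $S$, flat as a $k$-module (this is automatic when $k$ is a field). Write $\Delta(h)=h_{(1)}\otimes h_{(2)}$, $\otimes=\otimes_k$, and let all modules and (coassociative, counital) comodules be left ones unless said otherwise. An \emph{anti-Yetter--Drinfeld (AYD) module} is an $H$-module $X$ with an $H$-comodule structure $\rho(x)=x_{(-1)}\otimes x_{(0)}$ such that $$(hx)_{(-1)}\otimes (hx)_{(0)}=h_{(1)}x_{(-1)}S^{-1}(h_{(3)})\otimes h_{(2)}x_{(0)}\qquad(h\in H,\ x\in X);$$ it is \emph{stable} if $x_{(-1)}x_{(0)}=x$ for all $x\in X$. \emph{The complex $\mathcal K^*(H,X)$.} Let $\mathcal K^n(H)=H^{\otimes n+1}$ for $n\ge 0$, with the right action of $H$ by multiplication on the last tensor factor, with the differential $$d(h^0\otimes\cdots\otimes h^n)=-1\otimes h^0\otimes\cdots\otimes h^n+\sum_{j=0}^{n-1}(-1)^j h^0\otimes\cdots\otimes h^j_{(1)}\otimes h^j_{(2)}\otimes\cdots\otimes h^n+(-1)^n h^0\otimes\cdots\otimes h^{n-1}\otimes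 h^n_{(1)}S^{-1}(h^n_{(3)})\otimes h^n_{(2)},$$ and with the product of elements of $\mathcal K^n(H)$ with elements of $\mathcal K^1(H)$ $$(x^0\otimes\cdots\otimes x^n)(y^0\otimes y^1)=x^0\otimes\cdots\otimes x^{n-1}\otimes x^n_{(1)}y^0S^{-1}(x^n_{(3)})\otimes x^n_{(2)}y^1 .$$ For an AYD module $X$ put $\mathcal K^n(H,X)=\mathcal K^n(H)\otimes_H X$ and $\nabla(x)=x_{(-1)}\otimes x_{(0)}-1\otimes x$, an element of $H\otimes X\cong \mathcal K^1(H)\otimes_H X$, where $h\otimes x$ corresponds to $(h\otimes 1)\otimes_H x$. Then $\mathcal K^*(H,X)$ is a cochain complex of $k$-modules with the differential given by the extended connection $$\widehat\nabla(\omega\otimes x)=d(\omega)\otimes x+(-1)^n\,\omega\,\nabla(x)\qquad(\omega\in \mathcal K^n(H),\ x\in X).$$ \emph{Cotor.} Regard $k$ as a right $H$-comodule via $1\mapsto 1\otimes 1$. $\mathrm{Cotor}^n_H(k,X)$ is the value at $X$ of the $n$-th right derived functor of the cotensor product functor $k\,\square_H-$ from left $H$-comodules to $k$-modules. \emph{The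 Hopf-cyclic complex.} For a stable AYD module $X$ this is the cocyclic $k$-module $C^n=k\otimes_H(H^{\otimes n+1}\otimes X)$, $n\ge0$, the coinvariants of the diagonal action of $H$, with \begin{align*} \delta_i[c_0\otimes\cdots\otimes c_n\otimes x]&=[c_0\otimes\cdots\otimes c_{i(1)}\otimes c_{i(2)}\otimes\cdots\otimes c_n\otimes x]\quad(0\le i\le n),\\ \delta_{n+1}[c_0\otimes\cdots\otimes c_n\otimes x]&=[c_{0(2)}\otimes c_1\otimes\cdots\otimes c_n\otimes x_{(-1)}c_{0(1)}\otimes x_{(0)}],\\ \sigma_i[c_0\otimes\cdots\otimes c_{n+1}\otimes x]&=\varepsilon(c_{i+1})[c_0\otimes\cdots\otimes c_i\otimes c_{i+2}\otimes\cdots\otimes c_{n+1}\otimes x]\quad(0\le i\le n),\\ \tau[c_0\otimes\cdots\otimes c_n\otimes x]&=[c_1\otimes\cdots\otimes c_n\otimes x_{(-1)}c_0\otimes x_{(0)}]. \end{align*} Its Hochschild complex is $(C^*,b)$ with $b=\sum_{i=0}^{n+1}(-1)^i\delta_i$ on $C^n$. \textbf{Theorem.} For every AYD module $X$ over $H$ one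 has $$H_n(\mathcal K^*(H,X))\cong \mathrm{Cotor}_H^n(k,X)\qquad\text{for all } n\ge 0.$$ If $X$ is moreover stable, then $\mathcal K^*(H,X)$ is isomorphic, as a differential graded $k$-module, to the Hochschild complex of the Hopf-cyclic complex of $H$ with coefficients in $X$. -/

import Mathlib

open CategoryTheory CategoryTheory.Limits TensorProduct

universe u

set_option linter.unusedSectionVars false

noncomputable section

section Comodules

variable (k : Type u) [CommRing k] (C : Type u) [AddCommGroup C] [Module k C] [Coalgebra k C]

/-- A left `C`-comodule structure `ρ : X → C ⊗ X`, `x ↦ x₍₋₁₎ ⊗ x₍₀₎`, coassociative and counital. -/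
class LeftComodule (X : Type u) [AddCommGroup X] [Module k X] where
  coact : X →ₗ[k] C ⊗[k] X
  coassoc : (TensorProduct.assoc k C C X).toLinearMap ∘ₗ
      (Coalgebra.comul (R := k) (A := C)).rTensor X ∘ₗ coact = coact.lTensor C ∘ₗ coact
  counit_coact : (TensorProduct.lid k X).toLinearMap ∘ₗ
      (Coalgebra.counit (R := k) (A := C)).rTensor X ∘ₗ coact = LinearMap.id

/-- A right `C`-comodule structure `ρ : N → N ⊗ C`, coassociative and counital. -/
class RightComodule (N : Type u) [AddCommGroup N] [Module k N] where
  coact : N →ₗ[k] N ⊗[k] C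
  coassoc : (TensorProduct.assoc k N C C).toLinearMap ∘ₗ coact.rTensor C ∘ₗ coact =
      (Coalgebra.comul (R := k) (A := C)).lTensor N ∘ₗ coact
  counit_coact : (TensorProduct.rid k N).toLinearMap ∘ₗ
      (Coalgebra.counit (R := k) (A := C)).lTensor N ∘ₗ coact = LinearMap.id

/-- The comonad `C ⊗ -` on `k`-modules, with counit `ε ⊗ id` and comultiplication `Δ ⊗ id`. -/
def comoduleComonad : Comonad (ModuleCat.{u} k) where
  toFunctor :=
    { obj := fun M => ModuleCat.of k (C ⊗[k] M)
      map := fun f => ModuleCat.ofHom (f.hom.lTensor C)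
      map_id := fun M => ModuleCat.hom_ext (LinearMap.lTensor_id C M)
      map_comp := fun f g => ModuleCat.hom_ext (LinearMap.lTensor_comp C g.hom f.hom) }
  ε :=
    { app := fun M => ModuleCat.ofHom ((TensorProduct.lid k M).toLinearMap ∘ₗ
        (Coalgebra.counit (R := k) (A := C)).rTensor M)
      naturality := fun M N f => by
        apply ModuleCat.hom_ext
        apply TensorProduct.ext'
        intro a b
        exact (f.hom.map_smul (Coalgebra.counit (R := k) a) b).symm }
  δ :=
    { app := fun M => ModuleCat.ofHom ((TensorProduct.assoc k C C M).toLinearMap ∘ₗ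
        (Coalgebra.comul (R := k) (A := C)).rTensor M)
      naturality := fun M N f => by
        apply ModuleCat.hom_ext
        apply TensorProduct.ext'
        intro a b
        change TensorProduct.assoc k C C N (Coalgebra.comul (R := k) a ⊗ₜ f.hom b) =
          ((f.hom.lTensor C).lTensor C) (TensorProduct.assoc k C C M
            (Coalgebra.comul (R := k) a ⊗ₜ b))
        induction Coalgebra.comul (R := k) a using TensorProduct.induction_on with
        | zero => simp
        | tmul x y => simp
        | add x y hx hy => simp only [TensorProduct.add_tmul, map_add, hx, hy] }
  coassoc := fun M => by
    apply ModuleCat.hom_ext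
    apply TensorProduct.ext'
    intro a b
    let Φ : C ⊗[k] (C ⊗[k] C) →ₗ[k] C ⊗[k] (C ⊗[k] (C ⊗[k] M)) :=
      LinearMap.lTensor C ((TensorProduct.assoc k C C M).toLinearMap ∘ₗ
        (TensorProduct.mk k (C ⊗[k] C) M).flip b)
    have hΦ := congrArg Φ (Coalgebra.coassoc_apply (R := k) a)
    refine Eq.trans ?_ (hΦ.symm.trans ?_)
    · change LinearMap.lTensor C ((TensorProduct.assoc k C C M).toLinearMap ∘ₗ
        (Coalgebra.comul (R := k) (A := C)).rTensor M)
          (TensorProduct.assoc k C C M (Coalgebra.comul (R := k) a ⊗ₜ b)) = _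
      induction Coalgebra.comul (R := k) a using TensorProduct.induction_on with
      | zero => simp
      | tmul x y => simp [Φ]
      | add x y hx hy => simp only [TensorProduct.add_tmul, map_add, hx, hy]
    · change _ = TensorProduct.assoc k C C (C ⊗[k] M)
        ((Coalgebra.comul (R := k) (A := C)).rTensor (C ⊗[k] M)
          (TensorProduct.assoc k C C M (Coalgebra.comul (R := k) a ⊗ₜ b)))
      induction Coalgebra.comul (R := k) a using TensorProduct.induction_on with
      | zero => simp
      | tmul x y =>
        simp only [LinearMap.rTensor_tmul, TensorProduct.assoc_tmul]
        induction Coalgebra.comul (R := k) x using TensorProduct.induction_on with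
        | zero => simp
        | tmul z w => simp [Φ]
        | add z w hz hw => simp only [TensorProduct.add_tmul, map_add, hz, hw]
      | add x y hx hy => simp only [TensorProduct.add_tmul, map_add, hx, hy]
  left_counit := fun M => by
    apply ModuleCat.hom_ext
    apply TensorProduct.ext'
    intro a b
    change TensorProduct.lid k (C ⊗[k] M) ((Coalgebra.counit (R := k) (A := C)).rTensor (C ⊗[k] M)
      (TensorProduct.assoc k C C M (Coalgebra.comul (R := k) a ⊗ₜ b))) = a ⊗ₜ b
    have h := congrArg (fun z => (TensorProduct.lid k C z) ⊗ₜ[k] b)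
      (Coalgebra.rTensor_counit_comul (R := k) a)
    simp only [TensorProduct.lid_tmul, one_smul] at h
    rw [← h]
    induction Coalgebra.comul (R := k) a using TensorProduct.induction_on with
    | zero => simp
    | tmul x y => simp [TensorProduct.smul_tmul']
    | add x y hx hy => simp only [TensorProduct.add_tmul, map_add, hx, hy]
  right_counit := fun M => by
    apply ModuleCat.hom_ext
    apply TensorProduct.ext'
    intro a b
    change LinearMap.lTensor C ((TensorProduct.lid k M).toLinearMap ∘ₗ
      (Coalgebra.counit (R := k) (A := C)).rTensor M)
      (TensorProduct.assoc k C C M (Coalgebra.comul (R := k) a ⊗ₜ b)) = a ⊗ₜ b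
    have h := congrArg (fun z => (TensorProduct.rid k C z) ⊗ₜ[k] b)
      (Coalgebra.lTensor_counit_comul (R := k) a)
    simp only [TensorProduct.rid_tmul, one_smul] at h
    rw [← h]
    induction Coalgebra.comul (R := k) a using TensorProduct.induction_on with
    | zero => simp
    | tmul x y => simp [TensorProduct.smul_tmul]
    | add x y hx hy => simp only [TensorProduct.add_tmul, map_add, hx, hy]

instance : (comoduleComonad k C).toFunctor.Additive :=
  inferInstanceAs (MonoidalCategory.tensorLeft (ModuleCat.of k C)).Additive

/-- The category of left `C`-comodules: coalgebras over the comonad `C ⊗ -`, that is `k`-modules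
`X` with a coassociative counital map `X → C ⊗ X`; the morphisms are the colinear maps. -/
abbrev Comod : Type (u + 1) := (comoduleComonad k C).Coalgebra

instance [Module.Flat k C] : PreservesFiniteLimits (comoduleComonad k C).toFunctor :=
  haveI : Module.Flat k (ModuleCat.of k C) := ‹_›
  inferInstanceAs (PreservesFiniteLimits (MonoidalCategory.tensorLeft (ModuleCat.of k C)))

instance Comod.hasFiniteLimits [Module.Flat k C] : HasFiniteLimits (Comod k C) where
  out _ _ _ := ⟨fun D => Comonad.forget_creates_limits_of_comonad_preserves D⟩

instance Comod.hasFiniteColimits : HasFiniteColimits (Comod k C) where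
  out _ _ _ := ⟨fun D => Comonad.hasColimit_of_comp_forget_hasColimit D⟩

instance Comod.forget_preservesFiniteLimits [Module.Flat k C] :
    PreservesFiniteLimits (comoduleComonad k C).forget where
  preservesFiniteLimits _ _ _ := inferInstance

instance Comod.forget_preservesFiniteColimits :
    PreservesFiniteColimits (comoduleComonad k C).forget where
  preservesFiniteColimits _ _ _ := inferInstance

instance Comod.abelian [Module.Flat k C] : Abelian (Comod k C) := by
  have : ∀ {X Y : Comod k C} (f : X ⟶ Y), IsIso (Abelian.coimageImageComparison f) := by
    intro X Y f
    have h : IsIso ((comoduleComonad k C).forget.map (Abelian.coimageImageComparison f)) := by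
      have := Abelian.PreservesCoimageImageComparison.iso (comoduleComonad k C).forget f
      exact ((MorphismProperty.isomorphisms _).arrow_mk_iso_iff this).2
        (inferInstanceAs (IsIso (Abelian.coimageImageComparison _)))
    exact isIso_of_reflects_iso _ (comoduleComonad k C).forget
  exact Abelian.ofCoimageImageComparisonIsIso

instance Comod.enoughInjectives [Module.Flat k C] : EnoughInjectives (Comod k C) :=
  EnoughInjectives.of_adjunction (comoduleComonad k C).adj

/-- A `k`-module with a left coaction, as an object of the category of left comodules. -/
def Comod.of (X : Type u) [AddCommGroup X] [Module k X] [LeftComodule k C X] : Comod k C where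
  A := ModuleCat.of k X
  a := ModuleCat.ofHom (LeftComodule.coact (k := k) (C := C) (X := X))
  counit := ModuleCat.hom_ext LeftComodule.counit_coact
  coassoc := ModuleCat.hom_ext LeftComodule.coassoc

variable {k C} in
/-- The coaction of an object of the category of left comodules. -/
def Comod.coaction (M : Comod k C) : M.A →ₗ[k] C ⊗[k] M.A := M.a.hom

variable {k C} in
theorem Comod.coaction_map {M M' : Comod k C} (f : M ⟶ M') :
    M'.coaction ∘ₗ f.f.hom = f.f.hom.lTensor C ∘ₗ M.coaction :=
  (congrArg ModuleCat.Hom.hom f.h).symm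

variable (N : Type u) [AddCommGroup N] [Module k N] [RightComodule k C N]

/-- The cotensor product `N □_C M`: the submodule of `N ⊗ M` on which `ρ_N ⊗ id` and `id ⊗ ρ_M`
agree. -/
def cotensor (M : Comod k C) : Submodule k (N ⊗[k] M.A) :=
  LinearMap.eqLocus
    ((TensorProduct.assoc k N C M.A).toLinearMap ∘ₗ
      (RightComodule.coact (k := k) (C := C) (N := N)).rTensor M.A)
    (M.coaction.lTensor N)

theorem cotensor_map {M M' : Comod k C} (f : M ⟶ M') (z : N ⊗[k] M.A)
    (hz : z ∈ cotensor k C N M) : f.f.hom.lTensor N z ∈ cotensor k C N M' := by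
  have h1 : M'.coaction.lTensor N (f.f.hom.lTensor N z) =
      (f.f.hom.lTensor C).lTensor N (M.coaction.lTensor N z) := by
    rw [← LinearMap.comp_apply, ← LinearMap.comp_apply, ← LinearMap.lTensor_comp,
      ← LinearMap.lTensor_comp, Comod.coaction_map]
  have h2 : ∀ z : N ⊗[k] M.A, TensorProduct.assoc k N C M'.A
      ((RightComodule.coact (k := k) (C := C) (N := N)).rTensor M'.A (f.f.hom.lTensor N z)) =
      (f.f.hom.lTensor C).lTensor N (TensorProduct.assoc k N C M.A
        ((RightComodule.coact (k := k) (C := C) (N := N)).rTensor M.A z)) := by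
    intro z
    induction z using TensorProduct.induction_on with
    | zero => simp
    | tmul x y =>
      simp only [LinearMap.rTensor_tmul, LinearMap.lTensor_tmul]
      induction RightComodule.coact (k := k) (C := C) x using TensorProduct.induction_on with
      | zero => simp
      | tmul z w => simp
      | add z w hz hw => simp only [TensorProduct.add_tmul, map_add, hz, hw]
    | add x y hx hy => simp only [map_add, hx, hy]
  change TensorProduct.assoc k N C M'.A _ = _
  rw [h1, ← show TensorProduct.assoc k N C M.A _ = _ from hz]
  exact h2 z

/-- The functor `N □_C -` from left `C`-comodules to `k`-modules. -/
def cotensorFunctor : Comod k C ⥤ ModuleCat.{u} k where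
  obj M := ModuleCat.of k (cotensor k C N M)
  map f := ModuleCat.ofHom ((f.f.hom.lTensor N).restrict (cotensor_map k C N f))
  map_id M := ModuleCat.hom_ext (LinearMap.ext fun z => Subtype.ext
    (LinearMap.congr_fun (LinearMap.lTensor_id N M.A) z.1))
  map_comp f g := ModuleCat.hom_ext (LinearMap.ext fun z => Subtype.ext
    (LinearMap.congr_fun (LinearMap.lTensor_comp N g.f.hom f.f.hom) z.1))

instance cotensorFunctor.additive : (cotensorFunctor k C N).Additive where
  map_add {_ _ f g} := ModuleCat.hom_ext (LinearMap.ext fun z => Subtype.ext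
    (LinearMap.congr_fun (LinearMap.lTensor_add N f.f.hom g.f.hom) z.1))

/-- `Cotor_C^n(N, X)`: the `n`-th right derived functor of `N □_C -` on left `C`-comodules,
evaluated at `X`. -/
def Cotor [Module.Flat k C] (n : ℕ) (X : Type u) [AddCommGroup X] [Module k X]
    [LeftComodule k C X] : ModuleCat.{u} k :=
  ((cotensorFunctor k C N).rightDerived n).obj (Comod.of k C X)

end Comodules

/-- The ground ring as a right comodule over a bialgebra via the unit, `r ↦ r ⊗ 1`. -/
instance trivialRightComodule (k : Type u) [CommRing k] (H : Type u) [Ring H] [Bialgebra k H] :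
    RightComodule k H k where
  coact := (TensorProduct.mk k k H).flip 1
  coassoc := by ext; simp [Algebra.TensorProduct.one_def]
  counit_coact := by ext; simp

section TensorPowers

variable (k : Type u) [CommRing k] (H : Type u) [Ring H] [HopfAlgebra k H]

/-- `H ⊗ (H ⊗ ⋯ (H ⊗ M))` with `n` factors `H`. -/
def tensorPow (M : Type u) [AddCommGroup M] [Module k M] : ℕ → ModuleCat.{u} k
  | 0 => ModuleCat.of k M
  | n + 1 => ModuleCat.of k (H ⊗[k] tensorPow M n)

variable {k H} {M : Type u} [AddCommGroup M] [Module k M]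

namespace tensorPow

/-- The identification of `H^{⊗ 0} ⊗ M` with `M`. -/
def base : M ≃ₗ[k] tensorPow k H M 0 := LinearEquiv.refl k M

/-- `h, w ↦ h ⊗ w`. -/
def cons {n : ℕ} : H →ₗ[k] tensorPow k H M n →ₗ[k] tensorPow k H M (n + 1) :=
  TensorProduct.mk k H (tensorPow k H M n)

/-- The identification of `H^{⊗ 1} ⊗ M` with `H ⊗ M`. -/
def one : H ⊗[k] M ≃ₗ[k] tensorPow k H M 1 := LinearEquiv.refl k (H ⊗[k] M)

@[simp]
theorem one_tmul (h : H) (m : M) : one (h ⊗ₜ[k] m) = cons h (base m) := rfl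

@[simp]
theorem one_symm_cons (h : H) (m : M) :
    one.symm (cons h (base m) : tensorPow k H M 1) = h ⊗ₜ[k] m := rfl

theorem induction_zero {p : tensorPow k H M 0 → Prop} (v : tensorPow k H M 0)
    (h : ∀ m, p (base m)) : p v := h v

/-- The linear map `h ⊗ w ↦ f h w`. -/
def uncons {n : ℕ} {P : Type u} [AddCommGroup P] [Module k P]
    (f : H →ₗ[k] tensorPow k H M n →ₗ[k] P) : tensorPow k H M (n + 1) →ₗ[k] P :=
  TensorProduct.lift f

@[simp]
theorem uncons_cons {n : ℕ} {P : Type u} [AddCommGroup P] [Module k P]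
    (f : H →ₗ[k] tensorPow k H M n →ₗ[k] P) (h : H) (w : tensorPow k H M n) :
    uncons f (cons h w) = f h w := TensorProduct.lift.tmul h w

theorem induction {n : ℕ} {p : tensorPow k H M (n + 1) → Prop} (v : tensorPow k H M (n + 1))
    (hc : ∀ h w, p (cons h w)) (ha : ∀ v w, p v → p w → p (v + w)) : p v := by
  refine TensorProduct.induction_on (motive := p) v ?_ hc ha
  have := hc 0 0
  rwa [map_zero] at this

theorem hom_ext {n : ℕ} {P : Type u} [AddCommGroup P] [Module k P]
    {f g : tensorPow k H M (n + 1) →ₗ[k] P} (h : ∀ a w, f (cons a w) = g (cons a w)) : f = g :=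
  TensorProduct.ext' h

/-- `(a ⊗ b), w ↦ a ⊗ b ⊗ w`. -/
def cons₂ {n : ℕ} : H ⊗[k] H →ₗ[k] tensorPow k H M n →ₗ[k] tensorPow k H M (n + 2) :=
  TensorProduct.lift (LinearMap.mk₂ k (fun a b => cons a ∘ₗ cons b)
    (by intros; ext; simp) (by intros; ext; simp) (by intros; ext; simp) (by intros; ext; simp))

@[simp]
theorem cons₂_tmul {n : ℕ} (a b : H) (w : tensorPow k H M n) :
    cons₂ (a ⊗ₜ[k] b) w = cons a (cons b w) := by
  simp [cons₂]

/-- Given `f : M → P → H ⊗ M'`, apply `f` to the last tensor factor: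
`h₁ ⊗ ⋯ ⊗ hₙ ⊗ m, p ↦ h₁ ⊗ ⋯ ⊗ hₙ ⊗ f m p`. -/
def onLast {M' : Type u} [AddCommGroup M'] [Module k M'] {P : Type u} [AddCommGroup P] [Module k P]
    (f : M →ₗ[k] P →ₗ[k] H ⊗[k] M') :
    (n : ℕ) → tensorPow k H M n →ₗ[k] P →ₗ[k] tensorPow k H M' (n + 1)
  | 0 => f.compr₂ one.toLinearMap ∘ₗ base.symm.toLinearMap
  | n + 1 => uncons (LinearMap.mk₂ k (fun h w => cons h ∘ₗ onLast f n w)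
    (by intros; ext; simp) (by intros; ext; simp) (by intros; ext; simp) (by intros; ext; simp))

@[simp]
theorem onLast_base {M' : Type u} [AddCommGroup M'] [Module k M'] {P : Type u} [AddCommGroup P]
    [Module k P] (f : M →ₗ[k] P →ₗ[k] H ⊗[k] M') (m : M) (p : P) :
    onLast f 0 (base m) p = one (f m p) := rfl

@[simp]
theorem onLast_cons {M' : Type u} [AddCommGroup M'] [Module k M'] {P : Type u} [AddCommGroup P]
    [Module k P] (f : M →ₗ[k] P →ₗ[k] H ⊗[k] M') (n : ℕ) (h : H) (w : tensorPow k H M n) (p : P) :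
    onLast f (n + 1) (cons h w) p = cons h (onLast f n w p) := by
  simp [onLast]

/-- Given `ρ : M → H ⊗ M`, the map on `H^{⊗ n} ⊗ M` which applies the comultiplication to the
tensor factor number `j` (counted from `0`) if `j < n`, and which applies `ρ` to the last
factor if `j = n`. -/
def coface (ρ : M →ₗ[k] H ⊗[k] M) :
    (n : ℕ) → ℕ → (tensorPow k H M n →ₗ[k] tensorPow k H M (n + 1))
  | 0, _ => one.toLinearMap ∘ₗ ρ ∘ₗ base.symm.toLinearMap
  | _ + 1, 0 => uncons (cons₂ ∘ₗ Coalgebra.comul)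
  | n + 1, j + 1 => uncons (LinearMap.mk₂ k (fun h w => cons h (coface ρ n j w))
    (by intros; simp) (by intros; simp) (by intros; simp) (by intros; simp))

@[simp]
theorem coface_base (ρ : M →ₗ[k] H ⊗[k] M) (j : ℕ) (m : M) :
    coface ρ 0 j (base m) = one (ρ m) := rfl

@[simp]
theorem coface_cons_zero (ρ : M →ₗ[k] H ⊗[k] M) (n : ℕ) (h : H) (w : tensorPow k H M n) :
    coface ρ (n + 1) 0 (cons h w) = cons₂ (Coalgebra.comul (R := k) h) w := by
  simp [coface]

@[simp]
theorem coface_cons_succ (ρ : M →ₗ[k] H ⊗[k] M) (n j : ℕ) (h : H) (w : tensorPow k H M n) :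
    coface ρ (n + 1) (j + 1) (cons h w) = cons h (coface ρ n j w) := by
  simp [coface]

/-- The map on `H^{⊗ (n+1)} ⊗ M` which applies the counit to the tensor factor number `j ≤ n`
(counted from `0`). -/
def codegen : (n : ℕ) → ℕ → (tensorPow k H M (n + 1) →ₗ[k] tensorPow k H M n)
  | 0, _ => uncons (LinearMap.lsmul k _ ∘ₗ Coalgebra.counit)
  | _ + 1, 0 => uncons (LinearMap.lsmul k _ ∘ₗ Coalgebra.counit)
  | n + 1, j + 1 => uncons (LinearMap.mk₂ k (fun h w => cons h (codegen n j w))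
    (by intros; simp) (by intros; simp) (by intros; simp) (by intros; simp))

@[simp]
theorem codegen_zero_cons (j : ℕ) (h : H) (w : tensorPow k H M 0) :
    codegen 0 j (cons h w) = Coalgebra.counit (R := k) h • w := by
  simp [codegen]

@[simp]
theorem codegen_cons_zero (n : ℕ) (h : H) (w : tensorPow k H M n) :
    codegen n 0 (cons h w) = Coalgebra.counit (R := k) h • w := by
  cases n <;> simp [codegen]

@[simp]
theorem codegen_cons_succ (n j : ℕ) (h : H) (w : tensorPow k H M (n + 1)) :
    codegen (n + 1) (j + 1) (cons h w) = cons h (codegen n j w) := by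
  simp [codegen]

end tensorPow

end TensorPowers

section AYD

variable (k : Type u) [CommRing k] (H : Type u) [Ring H] [HopfAlgebra k H]

/-- The antipode of `H` is invertible. -/
class HasInvertibleAntipode : Prop where
  bijective : Function.Bijective (HopfAlgebra.antipode k (A := H))

/-- The inverse `S⁻¹` of the antipode. -/
def antipodeInv [HasInvertibleAntipode k H] : H →ₗ[k] H :=
  (LinearEquiv.ofBijective (HopfAlgebra.antipode k (A := H))
    HasInvertibleAntipode.bijective).symm.toLinearMap

variable {k H} in
@[simp]
theorem antipode_antipodeInv [HasInvertibleAntipode k H] (h : H) :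
    HopfAlgebra.antipode k (antipodeInv k H h) = h :=
  (LinearEquiv.ofBijective (HopfAlgebra.antipode k (A := H))
    HasInvertibleAntipode.bijective).apply_symm_apply h

theorem antipodeInv_eq [HasInvertibleAntipode k H] {h g : H}
    (e : HopfAlgebra.antipode k g = h) : antipodeInv k H h = g :=
  HasInvertibleAntipode.bijective.1 (by rw [antipode_antipodeInv, e])

theorem antipodeInv_mul [HasInvertibleAntipode k H] (g h : H) :
    antipodeInv k H (g * h) = antipodeInv k H h * antipodeInv k H g :=
  antipodeInv_eq k H (by rw [HopfAlgebra.antipode_mul_antidistrib]; simp)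

theorem antipodeInv_one [HasInvertibleAntipode k H] : antipodeInv k H 1 = 1 :=
  antipodeInv_eq k H HopfAlgebra.antipode_one

/-- `h ↦ h₍₁₎ ⊗ (h₍₂₎ ⊗ h₍₃₎)`. -/
def comul₃ : H →ₗ[k] H ⊗[k] (H ⊗[k] H) :=
  (Coalgebra.comul (R := k) (A := H)).lTensor H ∘ₗ Coalgebra.comul

/-- `a ⊗ (b ⊗ c) ↦ (a ⊗ c) ⊗ b`. -/
def permute₃ : H ⊗[k] (H ⊗[k] H) →ₗ[k] (H ⊗[k] H) ⊗[k] H :=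
  (TensorProduct.assoc k H H H).symm.toLinearMap ∘ₗ
    (TensorProduct.comm k H H).toLinearMap.lTensor H

/-- `a ⊗ c, g ↦ a g c`. -/
def mulBoth : H ⊗[k] H →ₗ[k] H →ₗ[k] H :=
  TensorProduct.lift (LinearMap.mk₂ k (fun a c => LinearMap.mulLeft k a ∘ₗ LinearMap.mulRight k c)
    (by intros; ext; simp [add_mul]) (by intros; ext; simp)
    (by intros; ext; simp [mul_add]) (by intros; ext; simp))

/-- `a ⊗ (b ⊗ c), g ⊗ x ↦ a g S⁻¹(c) ⊗ b x`. -/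
def adAct₃ [HasInvertibleAntipode k H] (M : Type u) [AddCommGroup M] [Module k M] [Module H M]
    [IsScalarTower k H M] : H ⊗[k] (H ⊗[k] H) →ₗ[k] (H ⊗[k] M) →ₗ[k] (H ⊗[k] M) :=
  TensorProduct.lift (TensorProduct.mapBilinear (RingHom.id k) H M H M) ∘ₗ
    TensorProduct.map (mulBoth k H ∘ₗ (antipodeInv k H).lTensor H)
      (Algebra.lsmul k k M).toLinearMap ∘ₗ permute₃ k H

/-- The action of `H` on `H ⊗ M`, for a left `H`-module `M`, given by
`h (g ⊗ x) = h₍₁₎ g S⁻¹(h₍₃₎) ⊗ h₍₂₎ x`. -/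
def adAct [HasInvertibleAntipode k H] (M : Type u) [AddCommGroup M] [Module k M] [Module H M]
    [IsScalarTower k H M] : H →ₗ[k] (H ⊗[k] M) →ₗ[k] (H ⊗[k] M) :=
  adAct₃ k H M ∘ₗ comul₃ k H

variable {k H} in
theorem adAct₃_tmul [HasInvertibleAntipode k H] {M : Type u} [AddCommGroup M] [Module k M]
    [Module H M] [IsScalarTower k H M] (a b c g : H) (x : M) :
    adAct₃ k H M (a ⊗ₜ (b ⊗ₜ c)) (g ⊗ₜ x) = (a * g * antipodeInv k H c) ⊗ₜ (b • x) := by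
  simp [adAct₃, permute₃, mulBoth, mul_assoc]

variable {k H} in
theorem comul₃_mul (g h : H) : comul₃ k H (g * h) = comul₃ k H g * comul₃ k H h :=
  map_mul ((Algebra.TensorProduct.map (AlgHom.id k H) (Bialgebra.comulAlgHom k H)).comp
    (Bialgebra.comulAlgHom k H)) g h

variable {k H} in
theorem comul₃_one : comul₃ k H 1 = 1 :=
  map_one ((Algebra.TensorProduct.map (AlgHom.id k H) (Bialgebra.comulAlgHom k H)).comp
    (Bialgebra.comulAlgHom k H))

variable {k H} in
theorem adAct₃_mul [HasInvertibleAntipode k H] {M : Type u} [AddCommGroup M] [Module k M]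
    [Module H M] [IsScalarTower k H M] (s t : H ⊗[k] (H ⊗[k] H)) (v : H ⊗[k] M) :
    adAct₃ k H M (s * t) v = adAct₃ k H M s (adAct₃ k H M t v) := by
  induction v using TensorProduct.induction_on with
  | zero => simp
  | add x y hx hy => simp only [map_add, hx, hy]
  | tmul g x =>
  induction s using TensorProduct.induction_on with
  | zero => simp
  | add x y hx hy => simp only [map_add, add_mul, LinearMap.add_apply, hx, hy]
  | tmul a s =>
  induction s using TensorProduct.induction_on with
  | zero => simp
  | add x y hx hy =>
    simp only [TensorProduct.tmul_add, map_add, add_mul, LinearMap.add_apply, hx, hy]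
  | tmul b c =>
  induction t using TensorProduct.induction_on with
  | zero => simp
  | add x y hx hy => simp only [map_add, mul_add, LinearMap.add_apply, hx, hy]
  | tmul a' t =>
  induction t using TensorProduct.induction_on with
  | zero => simp
  | add x y hx hy =>
    simp only [TensorProduct.tmul_add, map_add, mul_add, LinearMap.add_apply, hx, hy]
  | tmul b' c' =>
    simp only [Algebra.TensorProduct.tmul_mul_tmul, adAct₃_tmul, antipodeInv_mul, mul_assoc,
      mul_smul]

variable {k H} in
theorem adAct_mul [HasInvertibleAntipode k H] {M : Type u} [AddCommGroup M] [Module k M]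
    [Module H M] [IsScalarTower k H M] (g h : H) (v : H ⊗[k] M) :
    adAct k H M (g * h) v = adAct k H M g (adAct k H M h v) := by
  simp only [adAct, LinearMap.comp_apply, comul₃_mul, adAct₃_mul]

variable {k H} in
theorem adAct_one [HasInvertibleAntipode k H] {M : Type u} [AddCommGroup M] [Module k M]
    [Module H M] [IsScalarTower k H M] (v : H ⊗[k] M) : adAct k H M 1 v = v := by
  simp only [adAct, LinearMap.comp_apply, comul₃_one, Algebra.TensorProduct.one_def]
  induction v using TensorProduct.induction_on with
  | zero => simp
  | add x y hx hy => simp only [map_add, hx, hy]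
  | tmul g x => simp [adAct₃_tmul, antipodeInv_one]

/-- The coadjoint coaction `h ↦ h₍₁₎ S⁻¹(h₍₃₎) ⊗ h₍₂₎`. -/
def coadjoint [HasInvertibleAntipode k H] : H →ₗ[k] H ⊗[k] H :=
  (LinearMap.mul' k H ∘ₗ (antipodeInv k H).lTensor H).rTensor H ∘ₗ permute₃ k H ∘ₗ comul₃ k H

variable {k H} in
theorem coadjoint_eq [HasInvertibleAntipode k H] (h : H) :
    coadjoint k H h = adAct k H H h (1 ⊗ₜ 1) := by
  simp only [coadjoint, adAct, LinearMap.comp_apply]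
  induction comul₃ k H h using TensorProduct.induction_on with
  | zero => simp
  | add x y hx hy => simp only [map_add, LinearMap.add_apply, hx, hy]
  | tmul a s =>
  induction s using TensorProduct.induction_on with
  | zero => simp
  | add x y hx hy => simp only [TensorProduct.tmul_add, map_add, LinearMap.add_apply, hx, hy]
  | tmul b c => simp [adAct₃_tmul, permute₃]

variable (X : Type u) [AddCommGroup X] [Module k X] [Module H X] [IsScalarTower k H X]
  [LeftComodule k H X]

/-- The anti-Yetter-Drinfeld condition for a left `H`-module and left `H`-comodule `X`:
`(h x)₍₋₁₎ ⊗ (h x)₍₀₎ = h₍₁₎ x₍₋₁₎ S⁻¹(h₍₃₎) ⊗ h₍₂₎ x₍₀₎`. -/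
def IsAYD [HasInvertibleAntipode k H] : Prop :=
  ∀ (h : H) (x : X), LeftComodule.coact (k := k) (C := H) (h • x) =
    adAct k H X h (LeftComodule.coact x)

/-- Stability: `x₍₋₁₎ x₍₀₎ = x`. -/
def IsStable : Prop :=
  ∀ x : X, TensorProduct.lift (Algebra.lsmul k k X).toLinearMap
    (LeftComodule.coact (k := k) (C := H) x) = x

end AYD

section Calculus

open tensorPow

variable (k : Type u) [CommRing k] (H : Type u) [Ring H] [HopfAlgebra k H]

/-- The degree `n` part `K^n(H) = H^{⊗ (n+1)}` of the differential calculus `K^*(H)`. -/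
abbrev calculus (n : ℕ) : ModuleCat.{u} k := tensorPow k H H n

namespace calculus

variable {k H} in
/-- The right action of `H` on `K^n(H)`: `(x⁰ ⊗ ⋯ ⊗ xⁿ) h = x⁰ ⊗ ⋯ ⊗ xⁿ h`. -/
def rightMul (h : H) : (n : ℕ) → (calculus k H n →ₗ[k] calculus k H n)
  | 0 => base.toLinearMap ∘ₗ LinearMap.mulRight k h ∘ₗ base.symm.toLinearMap
  | n + 1 => uncons (LinearMap.mk₂ k (fun g w => cons g (rightMul h n w))
    (by intros; simp) (by intros; simp) (by intros; simp) (by intros; simp))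

variable {k H} in
@[simp]
theorem rightMul_base (h g : H) :
    rightMul h 0 (base g : calculus k H 0) = base (g * h) := rfl

variable {k H} in
@[simp]
theorem rightMul_cons (h : H) (n : ℕ) (g : H) (w : calculus k H n) :
    rightMul h (n + 1) (cons g w) = cons g (rightMul h n w) := by
  simp [rightMul]

variable {k H} in
theorem rightMul_one (h : H) (v : H ⊗[k] H) :
    rightMul h 1 (one v : calculus k H 1) = one ((LinearMap.mulRight k h).lTensor H v) := by
  induction v using TensorProduct.induction_on with
  | zero => simp
  | add x y hx hy => simp only [map_add, hx, hy]
  | tmul a b => simp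

variable {k H} in
theorem sum_coface_cons {M : Type u} [AddCommGroup M] [Module k M] (ρ : M →ₗ[k] H ⊗[k] M)
    (n : ℕ) (h : H) (w : tensorPow k H M n) :
    (∑ j ∈ Finset.range (n + 1 + 1), (-1 : ℤ) ^ j • coface ρ (n + 1) j) (cons h w) =
      cons₂ (Coalgebra.comul (R := k) h) w -
        cons h ((∑ j ∈ Finset.range (n + 1), (-1 : ℤ) ^ j • coface ρ n j) w) := by
  rw [Finset.sum_range_succ']
  simp only [LinearMap.add_apply, LinearMap.sum_apply, LinearMap.smul_apply, coface_cons_succ,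
    coface_cons_zero, pow_succ, map_sum, map_zsmul]
  simp [sub_eq_neg_add]

variable [HasInvertibleAntipode k H]

/-- The differential of `K^*(H)`:
`d(h⁰ ⊗ ⋯ ⊗ hⁿ) = - 1 ⊗ h⁰ ⊗ ⋯ ⊗ hⁿ + ∑_{j < n} (-1)^j h⁰ ⊗ ⋯ ⊗ h^j₍₁₎ ⊗ h^j₍₂₎ ⊗ ⋯ ⊗ hⁿ`
`  + (-1)^n h⁰ ⊗ ⋯ ⊗ h^{n-1} ⊗ hⁿ₍₁₎ S⁻¹(hⁿ₍₃₎) ⊗ hⁿ₍₂₎`. -/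
def d (n : ℕ) : calculus k H n →ₗ[k] calculus k H (n + 1) :=
  -cons 1 + ∑ j ∈ Finset.range (n + 1), (-1 : ℤ) ^ j • coface (coadjoint k H) n j

variable {k H}

/-- The product `K^n(H) ⊗ K^1(H) → K^{n+1}(H)`:
`(x⁰ ⊗ ⋯ ⊗ xⁿ)(y⁰ ⊗ y¹) = x⁰ ⊗ ⋯ ⊗ x^{n-1} ⊗ xⁿ₍₁₎ y⁰ S⁻¹(xⁿ₍₃₎) ⊗ xⁿ₍₂₎ y¹`. -/
def mulOne (n : ℕ) : calculus k H n →ₗ[k] calculus k H 1 →ₗ[k] calculus k H (n + 1) :=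
  onLast ((adAct k H H).compl₂ one.symm.toLinearMap) n

@[simp]
theorem mulOne_base (g : H) (v : H ⊗[k] H) :
    mulOne 0 (base g : calculus k H 0) (one v) = one (adAct k H H g v) := rfl

@[simp]
theorem mulOne_cons (n : ℕ) (h : H) (w : calculus k H n) (η : calculus k H 1) :
    mulOne (n + 1) (cons h w) η = cons h (mulOne n w η) := onLast_cons _ n h w η

theorem d_zero (h : H) : d k H 0 (base h) = one (coadjoint k H h - 1 ⊗ₜ h) := by
  simp [d, sub_eq_neg_add]

theorem adAct_mulRight (g h : H) (v : H ⊗[k] H) :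
    adAct k H H g ((LinearMap.mulRight k h).lTensor H v) =
      (LinearMap.mulRight k h).lTensor H (adAct k H H g v) := by
  simp only [adAct, LinearMap.comp_apply]
  induction v using TensorProduct.induction_on with
  | zero => simp
  | add x y hx hy => simp only [map_add, hx, hy]
  | tmul y z =>
  induction comul₃ k H g using TensorProduct.induction_on with
  | zero => simp
  | add x y hx hy => simp only [map_add, LinearMap.add_apply, hx, hy]
  | tmul a s =>
  induction s using TensorProduct.induction_on with
  | zero => simp
  | add x y hx hy => simp only [TensorProduct.tmul_add, map_add, LinearMap.add_apply, hx, hy]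
  | tmul b c => simp [adAct₃_tmul, mul_assoc]

theorem mulOne_rightMul (h : H) (n : ℕ) (ω : calculus k H n) (v : H ⊗[k] H) :
    mulOne n ω (rightMul h 1 (one v)) = rightMul h (n + 1) (mulOne n ω (one v)) := by
  induction n with
  | zero =>
    induction ω using tensorPow.induction_zero with
    | h g => rw [rightMul_one, mulOne_base, mulOne_base, rightMul_one, adAct_mulRight]
  | succ n ih =>
    induction ω using tensorPow.induction with
    | hc g w => simp only [mulOne_cons, rightMul_cons, ih]
    | ha x y hx hy => simp only [map_add, LinearMap.add_apply, hx, hy]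

theorem rightMul_mulOne (h : H) (n : ℕ) (ω : calculus k H n) (v : H ⊗[k] H) :
    mulOne n (rightMul h n ω) (one v) = mulOne n ω (one (adAct k H H h v)) := by
  induction n with
  | zero =>
    induction ω using tensorPow.induction_zero with
    | h g => rw [rightMul_base, mulOne_base, mulOne_base, adAct_mul]
  | succ n ih =>
    induction ω using tensorPow.induction with
    | hc g w => simp only [mulOne_cons, rightMul_cons, ih]
    | ha x y hx hy => simp only [map_add, LinearMap.add_apply, hx, hy]

theorem sum_coface_rightMul (h : H) (n : ℕ) (ω : calculus k H n) :
    (∑ j ∈ Finset.range (n + 1), (-1 : ℤ) ^ j • coface (coadjoint k H) n j) (rightMul h n ω) =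
      rightMul h (n + 1)
        ((∑ j ∈ Finset.range (n + 1), (-1 : ℤ) ^ j • coface (coadjoint k H) n j) ω) +
      (-1 : ℤ) ^ n • mulOne n ω (d k H 0 (base h)) := by
  induction n with
  | zero =>
    induction ω using tensorPow.induction_zero with
    | h g =>
    rw [d_zero, mulOne_base]
    simp only [zero_add, Finset.sum_range_one, pow_zero, one_smul, rightMul_base, coface_base,
      coadjoint_eq, map_sub]
    rw [show rightMul h (0 + 1) = rightMul (k := k) h 1 from rfl, rightMul_one, ← adAct_mulRight,
      adAct_mul]
    simp
  | succ n ih =>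
    induction ω using tensorPow.induction with
    | hc g w =>
      rw [rightMul_cons, sum_coface_cons, sum_coface_cons, ih, mulOne_cons, map_sub, rightMul_cons]
      have : rightMul h (n + 1 + 1) (cons₂ (Coalgebra.comul (R := k) g) w) =
          cons₂ (Coalgebra.comul (R := k) g) (rightMul h n w) := by
        induction Coalgebra.comul (R := k) g using TensorProduct.induction_on with
        | zero => simp
        | tmul a b => simp
        | add x y hx hy => simp only [map_add, LinearMap.add_apply, hx, hy]
      rw [this, pow_succ, map_add, map_zsmul]
      simp only [mul_neg, mul_one, neg_smul]
      abel
    | ha x y hx hy =>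
      simp only [map_add, LinearMap.add_apply, hx, hy, smul_add]
      abel

theorem d_rightMul (h : H) (n : ℕ) (ω : calculus k H n) :
    d k H n (rightMul h n ω) = rightMul h (n + 1) (d k H n ω) +
      (-1 : ℤ) ^ n • mulOne n ω (d k H 0 (base h)) := by
  have : ∀ ω, d k H n ω = -cons 1 ω +
    (∑ j ∈ Finset.range (n + 1), (-1 : ℤ) ^ j • coface (coadjoint k H) n j) ω := fun _ => rfl
  rw [this, this, sum_coface_rightMul, map_add, map_neg, rightMul_cons, add_assoc]

variable (X : Type u) [AddCommGroup X] [Module k X] [Module H X] [IsScalarTower k H X]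

/-- The relations `ω h ⊗ x = ω ⊗ h x` of the tensor product over `H`. -/
def balanced (n : ℕ) : Submodule k (calculus k H n ⊗[k] X) :=
  Submodule.span k {z | ∃ (ω : calculus k H n) (h : H) (x : X),
    z = rightMul h n ω ⊗ₜ x - ω ⊗ₜ (h • x)}

variable (k H) in
/-- The `k`-module `K^n(H) ⊗_H X`. -/
abbrev tensorOver (n : ℕ) : Type u := (calculus k H n ⊗[k] X) ⧸ balanced (k := k) (H := H) X n

variable {X}

/-- `ω ⊗_H x`. -/
def tmulOver (n : ℕ) : calculus k H n →ₗ[k] X →ₗ[k] tensorOver k H X n :=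
  (TensorProduct.mk k (calculus k H n) X).compr₂ (balanced X n).mkQ

theorem tmulOver_rightMul (n : ℕ) (ω : calculus k H n) (h : H) (x : X) :
    tmulOver n (rightMul h n ω) x = tmulOver n ω (h • x) :=
  (Submodule.Quotient.eq _).2 (Submodule.subset_span ⟨ω, h, x, rfl⟩)

/-- The map on `K^n(H) ⊗_H X` induced by a balanced bilinear map. -/
def liftOver {P : Type u} [AddCommGroup P] [Module k P] (n : ℕ)
    (f : calculus k H n →ₗ[k] X →ₗ[k] P)
    (hf : ∀ ω h x, f (rightMul h n ω) x = f ω (h • x)) : tensorOver k H X n →ₗ[k] P :=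
  (balanced X n).liftQ (TensorProduct.lift f) (Submodule.span_le.2 (by
    rintro _ ⟨ω, h, x, rfl⟩
    simp [hf]))

@[simp]
theorem liftOver_tmulOver {P : Type u} [AddCommGroup P] [Module k P] (n : ℕ)
    (f : calculus k H n →ₗ[k] X →ₗ[k] P)
    (hf : ∀ ω h x, f (rightMul h n ω) x = f ω (h • x)) (ω : calculus k H n) (x : X) :
    liftOver n f hf (tmulOver n ω x) = f ω x := rfl

theorem hom_ext_over {P : Type u} [AddCommGroup P] [Module k P] {n : ℕ}
    {f g : tensorOver k H X n →ₗ[k] P}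
    (h : ∀ ω x, f (tmulOver n ω x) = g (tmulOver n ω x)) : f = g :=
  Submodule.linearMap_qext _ (TensorProduct.ext' h)

/-- Left multiplication `K^1(H) ⊗_H X → K^{n+1}(H) ⊗_H X`, `η ⊗ x ↦ ω η ⊗ x` by `ω ∈ K^n(H)`. -/
def mulOver (n : ℕ) (ω : calculus k H n) : tensorOver k H X 1 →ₗ[k] tensorOver k H X (n + 1) :=
  liftOver 1 (tmulOver (n + 1) ∘ₗ mulOne n ω) (fun η h x => by
    obtain ⟨v, rfl⟩ := one.surjective η
    simp only [LinearMap.comp_apply, mulOne_rightMul, tmulOver_rightMul])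

@[simp]
theorem mulOver_tmulOver (n : ℕ) (ω : calculus k H n) (η : calculus k H 1) (x : X) :
    mulOver n ω (tmulOver 1 η x) = tmulOver (n + 1) (mulOne n ω η) x := rfl

theorem mulOver_add (n : ℕ) (ω ω' : calculus k H n) (z : tensorOver k H X 1) :
    mulOver n (ω + ω') z = mulOver n ω z + mulOver n ω' z := by
  refine LinearMap.congr_fun (f := mulOver n (ω + ω')) (g := mulOver n ω + mulOver n ω')
    (hom_ext_over fun η x => ?_) z
  simp

theorem mulOver_smul (n : ℕ) (c : k) (ω : calculus k H n) (z : tensorOver k H X 1) :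
    mulOver n (c • ω) z = c • mulOver n ω z := by
  refine LinearMap.congr_fun (f := mulOver n (c • ω)) (g := c • mulOver n ω)
    (hom_ext_over fun η x => ?_) z
  simp

variable [LeftComodule k H X]

variable (k H) in
/-- `h ⊗ x ↦ (h ⊗ 1) ⊗_H x`, identifying `H ⊗ X` with `K^1(H) ⊗_H X`. -/
def embed : H ⊗[k] X →ₗ[k] tensorOver k H X 1 :=
  TensorProduct.lift (tmulOver 1 ∘ₗ cons.flip (base (1 : H)))

variable (k H X) in
/-- The connection `∇(x) = ρ(x) - 1 ⊗ x`, as a map `X → K^1(H) ⊗_H X`. -/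
def connection : X →ₗ[k] tensorOver k H X 1 :=
  embed k H ∘ₗ (LeftComodule.coact - TensorProduct.mk k H X 1)

theorem embed_adAct (h : H) (v : H ⊗[k] X) :
    embed k H (adAct k H X h v) = mulOver 0 (base h) (embed k H v) := by
  induction v using TensorProduct.induction_on with
  | zero => simp
  | add x y hx hy => simp only [map_add, hx, hy]
  | tmul g x =>
  have : mulOver 0 (base h) (embed k H (g ⊗ₜ x)) =
      tmulOver 1 (one (adAct k H H h (g ⊗ₜ (1 : H)))) x := rfl
  rw [this]
  simp only [adAct, LinearMap.comp_apply]
  induction comul₃ k H h using TensorProduct.induction_on with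
  | zero => simp
  | add x y hx hy => simp only [map_add, LinearMap.add_apply, hx, hy]
  | tmul a s =>
  induction s using TensorProduct.induction_on with
  | zero => simp
  | add x y hx hy => simp only [TensorProduct.tmul_add, map_add, LinearMap.add_apply, hx, hy]
  | tmul b c =>
    rw [adAct₃_tmul, adAct₃_tmul, one_tmul]
    change tmulOver 1 (cons (a * g * antipodeInv k H c) (base (1 : H))) (b • x) = _
    rw [← tmulOver_rightMul, rightMul_cons, rightMul_base, one_mul, smul_eq_mul, mul_one]

/-- The Leibniz rule `∇(h x) = h ∇(x) + d(h) ⊗ x`. -/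
theorem connection_smul (hX : IsAYD k H X) (h : H) (x : X) :
    connection k H X (h • x) =
      mulOver 0 (base h) (connection k H X x) + tmulOver 1 (d k H 0 (base h)) x := by
  have e1 : embed k H ((1 : H) ⊗ₜ[k] (h • x)) = tmulOver 1 (one ((1 : H) ⊗ₜ[k] h)) x := by
    change tmulOver 1 (cons (1 : H) (base (1 : H))) (h • x) = _
    rw [← tmulOver_rightMul, rightMul_cons, rightMul_base, one_mul]
    rfl
  have e2 : mulOver 0 (base h) (embed k H ((1 : H) ⊗ₜ[k] x)) =
      tmulOver 1 (one (coadjoint k H h)) x := by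
    rw [coadjoint_eq]
    rfl
  simp only [connection, LinearMap.comp_apply, LinearMap.sub_apply, map_sub, hX h x, embed_adAct,
    TensorProduct.mk_apply, e1, e2, d_zero]
  abel

theorem mulOver_rightMul (n : ℕ) (ω : calculus k H n) (h : H) (z : tensorOver k H X 1) :
    mulOver n (rightMul h n ω) z = mulOver n ω (mulOver 0 (base h) z) := by
  refine LinearMap.congr_fun (f := mulOver n (rightMul h n ω))
    (g := mulOver n ω ∘ₗ mulOver 0 (base h)) (hom_ext_over fun η x => ?_) z
  obtain ⟨v, rfl⟩ := one.surjective η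
  simp [rightMul_mulOne]

variable (k H X) in
/-- The extension of the connection to `K^*(H) ⊗_H X`:
`∇(ω ⊗ x) = d(ω) ⊗ x + (-1)^n ω ∇(x)` for `ω ∈ K^n(H)`. -/
def extendedConnection (hX : IsAYD k H X) (n : ℕ) :
    tensorOver k H X n →ₗ[k] tensorOver k H X (n + 1) :=
  liftOver n
    (LinearMap.mk₂ k (fun ω x => tmulOver (n + 1) (d k H n ω) x +
        (-1 : ℤ) ^ n • mulOver n ω (connection k H X x))
      (by intros; simp only [map_add, LinearMap.add_apply, mulOver_add, smul_add]; abel)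
      (by intros; simp only [map_smul, LinearMap.smul_apply, mulOver_smul, smul_add,
            smul_comm ((-1 : ℤ) ^ n)])
      (by intros; simp only [map_add, smul_add]; abel)
      (by intros; simp only [map_smul, smul_add, smul_comm ((-1 : ℤ) ^ n)]))
    (fun ω h x => by
      simp only [LinearMap.mk₂_apply, d_rightMul, map_add, LinearMap.add_apply, tmulOver_rightMul,
        mulOver_rightMul, connection_smul hX, mulOver_tmulOver, map_zsmul, LinearMap.smul_apply,
        smul_add]
      abel)

theorem extendedConnection_tmulOver (hX : IsAYD k H X) (n : ℕ) (ω : calculus k H n) (x : X) :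
    extendedConnection k H X hX n (tmulOver n ω x) = tmulOver (n + 1) (d k H n ω) x +
      (-1 : ℤ) ^ n • mulOver n ω (connection k H X x) := rfl

end calculus

end Calculus

section CobarComplex

open tensorPow calculus

variable {k : Type u} [CommRing k] {H : Type u} [Ring H] [HopfAlgebra k H]
variable {X : Type u} [AddCommGroup X] [Module k X] [LeftComodule k H X]

/-- The alternating sum of the maps `coface`. -/
abbrev sumCoface {M : Type u} [AddCommGroup M] [Module k M] (ρ : M →ₗ[k] H ⊗[k] M) (n : ℕ) :
    tensorPow k H M n →ₗ[k] tensorPow k H M (n + 1) :=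
  ∑ j ∈ Finset.range (n + 1), (-1 : ℤ) ^ j • coface ρ n j

theorem sumCoface_base {M : Type u} [AddCommGroup M] [Module k M] (ρ : M →ₗ[k] H ⊗[k] M) (m : M) :
    sumCoface ρ 0 (base m) = one (ρ m) := by
  simp [sumCoface]

/-- `h₁ ⊗ h₂ ⊗ h₃, w ↦ h₁ ⊗ h₂ ⊗ h₃ ⊗ w`. -/
def cons₃ {M : Type u} [AddCommGroup M] [Module k M] {n : ℕ} (w : tensorPow k H M n) :
    H ⊗[k] (H ⊗[k] H) →ₗ[k] tensorPow k H M (n + 3) :=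
  TensorProduct.lift (LinearMap.mk₂ k (fun a s => cons a (cons₂ s w))
    (by intros; simp) (by intros; simp) (by intros; simp) (by intros; simp))

/-- Coassociativity of `Δ` in a tensor power. -/
theorem coface_coassoc {M : Type u} [AddCommGroup M] [Module k M] (ρ : M →ₗ[k] H ⊗[k] M)
    {n : ℕ} (h : H) (w : tensorPow k H M n) :
    coface ρ (n + 2) 0 (cons₂ (Coalgebra.comul (R := k) h) w) =
      coface ρ (n + 2) 1 (cons₂ (Coalgebra.comul (R := k) h) w) := by
  have key := congrArg (cons₃ w) (Coalgebra.coassoc_apply (R := k) h)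
  have h1 : ∀ s : H ⊗[k] H, coface ρ (n + 2) 0 (cons₂ s w) = cons₃ w
      (TensorProduct.assoc k H H H ((Coalgebra.comul (R := k) (A := H)).rTensor H s)) := by
    intro s
    induction s using TensorProduct.induction_on with
    | zero => simp
    | add x y hx hy => simp only [map_add, LinearMap.add_apply, hx, hy]
    | tmul a b =>
      simp only [cons₂_tmul, coface_cons_zero, LinearMap.rTensor_tmul]
      induction Coalgebra.comul (R := k) a using TensorProduct.induction_on with
      | zero => simp
      | add x y hx hy => simp only [map_add, LinearMap.add_apply, TensorProduct.add_tmul, hx, hy]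
      | tmul c d => simp [cons₃]
  have h2 : ∀ s : H ⊗[k] H, coface ρ (n + 2) 1 (cons₂ s w) = cons₃ w
      ((Coalgebra.comul (R := k) (A := H)).lTensor H s) := by
    intro s
    induction s using TensorProduct.induction_on with
    | zero => simp
    | add x y hx hy => simp only [map_add, LinearMap.add_apply, hx, hy]
    | tmul a b => simp [cons₃]
  rw [h1, h2, key]

theorem sumCoface_cons₂ {M : Type u} [AddCommGroup M] [Module k M] (ρ : M →ₗ[k] H ⊗[k] M)
    {n : ℕ} (s : H ⊗[k] H) (w : tensorPow k H M n) :
    sumCoface ρ (n + 2) (cons₂ s w) = coface ρ (n + 2) 0 (cons₂ s w) -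
      coface ρ (n + 2) 1 (cons₂ s w) + cons₂ s (sumCoface ρ n w) := by
  induction s using TensorProduct.induction_on with
  | zero => simp
  | add x y hx hy =>
    simp only [map_add, LinearMap.add_apply, hx, hy]
    abel
  | tmul a b =>
    rw [cons₂_tmul, sum_coface_cons, sum_coface_cons, coface_cons_zero, coface_cons_succ,
      coface_cons_zero, cons₂_tmul, map_sub]
    abel

theorem sumCoface_sumCoface (n : ℕ) (w : tensorPow k H X n) :
    sumCoface LeftComodule.coact (n + 1) (sumCoface LeftComodule.coact n w) = 0 := by
  induction n with
  | zero =>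
    induction w using tensorPow.induction_zero with
    | h x =>
    rw [sumCoface_base]
    have key := LinearMap.congr_fun (LeftComodule.coassoc (k := k) (C := H) (X := X)) x
    simp only [LinearMap.comp_apply] at key
    let Φ : H ⊗[k] (H ⊗[k] X) →ₗ[k] tensorPow k H X 2 :=
      TensorProduct.lift (LinearMap.mk₂ k (fun a s => cons a (one s))
        (by intros; simp) (by intros; simp) (by intros; simp) (by intros; simp))
    have h1 : ∀ s : H ⊗[k] X, sumCoface LeftComodule.coact 1 (one s) =
        Φ (TensorProduct.assoc k H H X ((Coalgebra.comul (R := k) (A := H)).rTensor X s)) -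
          Φ (LeftComodule.coact.lTensor H s) := by
      intro s
      induction s using TensorProduct.induction_on with
      | zero => simp
      | add x y hx hy =>
        simp only [map_add, hx, hy]
        abel
      | tmul a y =>
        rw [one_tmul, sum_coface_cons, LinearMap.rTensor_tmul, LinearMap.lTensor_tmul]
        congr 1
        · induction Coalgebra.comul (R := k) a using TensorProduct.induction_on with
          | zero => simp
          | add x y hx hy =>
            simp only [map_add, LinearMap.add_apply, TensorProduct.add_tmul, hx, hy]
          | tmul c d => simp [Φ]
        · rw [sumCoface_base]
          simp [Φ]
    rw [h1, ← key]
    exact sub_self _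
  | succ n ih =>
    induction w using tensorPow.induction with
    | ha x y hx hy => rw [map_add, map_add, hx, hy, add_zero]
    | hc h w =>
      rw [sum_coface_cons, map_sub, sumCoface_cons₂, coface_coassoc, sum_coface_cons, ih]
      simp

variable (k H X) in
/-- The differential `w ↦ - 1 ⊗ w + ∑_j (-1)^j ⋯` on `H^{⊗ n} ⊗ X`. -/
abbrev cobarD (n : ℕ) : tensorPow k H X n →ₗ[k] tensorPow k H X (n + 1) :=
  -cons 1 + sumCoface LeftComodule.coact n

theorem cobarD_cobarD (n : ℕ) (w : tensorPow k H X n) :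
    cobarD k H X (n + 1) (cobarD k H X n w) = 0 := by
  simp only [cobarD, LinearMap.add_apply, LinearMap.neg_apply, map_add, map_neg]
  rw [sumCoface_sumCoface, sum_coface_cons]
  simp [Algebra.TensorProduct.one_def]

variable [HasInvertibleAntipode k H] [Module H X] [IsScalarTower k H X]

/-- `h ⊗ -` on `K^*(H) ⊗_H X`. -/
def consOver (h : H) (n : ℕ) : tensorOver k H X n →ₗ[k] tensorOver k H X (n + 1) :=
  liftOver n (tmulOver (n + 1) ∘ₗ cons h) (fun ω g x => by
    simp only [LinearMap.comp_apply, ← tmulOver_rightMul, rightMul_cons])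

/-- `s ⊗ -` on `K^*(H) ⊗_H X` for `s ∈ H ⊗ H`. -/
def cons₂Over (s : H ⊗[k] H) (n : ℕ) : tensorOver k H X n →ₗ[k] tensorOver k H X (n + 2) :=
  liftOver n (tmulOver (n + 2) ∘ₗ cons₂ s) (fun ω g x => by
    simp only [LinearMap.comp_apply, ← tmulOver_rightMul]
    induction s using TensorProduct.induction_on with
    | zero => simp
    | add x y hx hy => simp only [map_add, LinearMap.add_apply, hx, hy]
    | tmul a b => simp)

theorem consOver_tmulOver (h : H) (n : ℕ) (ω : calculus k H n) (x : X) :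
    consOver h n (tmulOver n ω x) = tmulOver (n + 1) (cons h ω) x := rfl

theorem mulOver_cons (h : H) (n : ℕ) (ω : calculus k H n) (z : tensorOver k H X 1) :
    mulOver (n + 1) (cons h ω) z = consOver h (n + 1) (mulOver n ω z) := by
  refine LinearMap.congr_fun (f := mulOver (n + 1) (cons h ω))
    (g := consOver h (n + 1) ∘ₗ mulOver n ω) (hom_ext_over fun η x => ?_) z
  simp [consOver_tmulOver]

/-- The map `H^{⊗ n} ⊗ X → K^n(H) ⊗ X`, `w ⊗ x ↦ (w ⊗ 1) ⊗ x`. -/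
def insertOne : (n : ℕ) → tensorPow k H X n →ₗ[k] calculus k H n ⊗[k] X
  | 0 => TensorProduct.mk k (calculus k H 0) X (base 1) ∘ₗ base.symm.toLinearMap
  | n + 1 => uncons (LinearMap.mk₂ k (fun h w => (cons h).rTensor X (insertOne n w))
    (by intros; simp) (by intros; simp) (by intros; simp) (by intros; simp))

/-- The map `H^{⊗ n} ⊗ X → K^n(H) ⊗_H X`, `w ⊗ x ↦ (w ⊗ 1) ⊗ x`. -/
def ofCobar (n : ℕ) : tensorPow k H X n →ₗ[k] tensorOver k H X n :=
  (balanced X n).mkQ ∘ₗ insertOne n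

theorem ofCobar_base (x : X) :
    ofCobar (k := k) (H := H) 0 (base x) = tmulOver 0 (base (1 : H)) x := rfl

theorem ofCobar_cons (n : ℕ) (h : H) (w : tensorPow k H X n) :
    ofCobar (n + 1) (cons h w) = consOver h n (ofCobar n w) := by
  simp only [ofCobar, LinearMap.comp_apply, insertOne, uncons_cons, LinearMap.mk₂_apply]
  induction insertOne n w using TensorProduct.induction_on with
  | zero => simp
  | add x y hx hy => simp only [map_add, hx, hy]
  | tmul ω x => rfl

theorem ofCobar_cons₂ (n : ℕ) (s : H ⊗[k] H) (w : tensorPow k H X n) :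
    ofCobar (n + 2) (cons₂ s w) = cons₂Over s n (ofCobar n w) := by
  have : ∀ s : H ⊗[k] H, ∀ z : tensorOver k H X n, ∀ a b : H,
      cons₂Over (a ⊗ₜ[k] b) n z = consOver a (n + 1) (consOver b n z) := by
    intro s z a b
    refine LinearMap.congr_fun (f := cons₂Over (a ⊗ₜ[k] b) n)
      (g := consOver a (n + 1) ∘ₗ consOver b n) (hom_ext_over fun η x => ?_) z
    simp [consOver_tmulOver, cons₂Over]
  have hadd : ∀ s t : H ⊗[k] H, ∀ z : tensorOver k H X n,
      cons₂Over (s + t) n z = cons₂Over s n z + cons₂Over t n z := by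
    intro s t z
    refine LinearMap.congr_fun (f := cons₂Over (s + t) n)
      (g := cons₂Over s n + cons₂Over t n) (hom_ext_over fun η x => ?_) z
    simp [cons₂Over]
  induction s using TensorProduct.induction_on with
  | zero =>
    have h0 := hadd 0 0 (ofCobar n w)
    rw [add_zero, left_eq_add] at h0
    simp [h0]
  | add x y hx hy => simp only [map_add, LinearMap.add_apply, hx, hy, hadd]
  | tmul a b => rw [cons₂_tmul, ofCobar_cons, ofCobar_cons, this (a ⊗ₜ b)]

theorem ofCobar_surjective (n : ℕ) : Function.Surjective (ofCobar (k := k) (H := H) (X := X) n) := by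
  rw [← LinearMap.range_eq_top, eq_top_iff]
  have key : ∀ (ω : calculus k H n) (x : X), tmulOver n ω x ∈ LinearMap.range (ofCobar n) := by
    intro ω x
    induction n with
    | zero =>
      induction ω using tensorPow.induction_zero with
      | h g =>
      refine ⟨base (g • x), ?_⟩
      rw [ofCobar_base, ← tmulOver_rightMul, rightMul_base, one_mul]
    | succ n ih =>
      induction ω using tensorPow.induction with
      | ha x y hx hy =>
        rw [map_add]
        exact Submodule.add_mem _ hx hy
      | hc h w =>
        obtain ⟨v, hv⟩ := ih w
        exact ⟨cons h v, by rw [ofCobar_cons, hv, consOver_tmulOver]⟩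
  rintro z -
  obtain ⟨z, rfl⟩ := Submodule.mkQ_surjective _ z
  induction z using TensorProduct.induction_on with
  | zero => simp
  | add x y hx hy =>
    rw [map_add]
    exact Submodule.add_mem _ hx hy
  | tmul ω x => exact key ω x

theorem extendedConnection_ofCobar (hX : IsAYD k H X) (n : ℕ) (w : tensorPow k H X n) :
    extendedConnection k H X hX n (ofCobar n w) = ofCobar (n + 1) (cobarD k H X n w) := by
  have key : ∀ w : tensorPow k H X n, extendedConnection k H X hX n (ofCobar n w) +
      consOver 1 n (ofCobar n w) = ofCobar (n + 1) (sumCoface LeftComodule.coact n w) := by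
    clear w
    intro w
    induction n with
    | zero =>
      induction w using tensorPow.induction_zero with
      | h x =>
      have h1 : ∀ z : tensorOver k H X 1, mulOver 0 (base (1 : H)) z = z := by
        intro z
        refine LinearMap.congr_fun (f := mulOver 0 (base (1 : H))) (g := LinearMap.id)
          (hom_ext_over fun η x => ?_) z
        obtain ⟨v, rfl⟩ := one.surjective η
        simp [adAct_one]
      have h2 : ∀ s : H ⊗[k] X, ofCobar 1 (one s) = embed k H s := by
        intro s
        induction s using TensorProduct.induction_on with
        | zero => simp
        | add x y hx hy => simp only [map_add, hx, hy]
        | tmul a y => rfl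
      rw [ofCobar_base, extendedConnection_tmulOver, h1, consOver_tmulOver, d_zero, coadjoint_eq,
        adAct_one, sub_self, sumCoface_base, h2]
      simp only [map_zero, LinearMap.zero_apply, pow_zero, one_smul, zero_add, connection,
        LinearMap.comp_apply, LinearMap.sub_apply, map_sub]
      have : embed k H (TensorProduct.mk k H X 1 x) =
        tmulOver (0 + 1) (cons (1 : H) (base (1 : H))) x := rfl
      rw [this]
      exact sub_add_cancel _ _
    | succ n ih =>
      induction w using tensorPow.induction with
      | ha x y hx hy =>
        simp only [map_add] at hx hy ⊢
        rw [← hx, ← hy]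
        abel
      | hc h w =>
        rw [sum_coface_cons, map_sub, ofCobar_cons₂, ofCobar_cons, ofCobar_cons, ← ih]
        generalize ofCobar n w = z
        let f : tensorOver k H X n →ₗ[k] tensorOver k H X (n + 2) :=
          extendedConnection k H X hX (n + 1) ∘ₗ consOver h n + consOver 1 (n + 1) ∘ₗ consOver h n
        let g : tensorOver k H X n →ₗ[k] tensorOver k H X (n + 2) :=
          cons₂Over (Coalgebra.comul (R := k) h) n -
            consOver h (n + 1) ∘ₗ (extendedConnection k H X hX n + consOver 1 n)
        refine LinearMap.congr_fun (f := f) (g := g) (hom_ext_over fun ω x => ?_) z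
        have hd : ∀ m, d k H m = -cons 1 + sumCoface (coadjoint k H) m := fun _ => rfl
        simp only [f, g, LinearMap.add_apply, LinearMap.sub_apply, LinearMap.comp_apply,
          consOver_tmulOver, extendedConnection_tmulOver, mulOver_cons, hd, LinearMap.neg_apply,
          map_add, map_neg, map_zsmul, cons₂Over, liftOver_tmulOver, sum_coface_cons, map_sub,
          pow_succ]
        simp only [mul_neg, mul_one, neg_smul]
        abel
  rw [eq_sub_of_add_eq (key w)]
  simp only [cobarD, LinearMap.add_apply, LinearMap.neg_apply, map_add, map_neg, ofCobar_cons]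
  abel

theorem extendedConnection_comp (hX : IsAYD k H X) (n : ℕ) :
    extendedConnection k H X hX (n + 1) ∘ₗ extendedConnection k H X hX n = 0 := by
  refine LinearMap.ext fun z => ?_
  obtain ⟨w, rfl⟩ := ofCobar_surjective n z
  rw [LinearMap.comp_apply, extendedConnection_ofCobar, extendedConnection_ofCobar, cobarD_cobarD,
    map_zero, LinearMap.zero_apply]

variable (k H X) in
/-- The complex `K^*(H, X) = K^*(H) ⊗_H X` with the extended connection as its differential. -/
def calculusComplex (hX : IsAYD k H X) : CochainComplex (ModuleCat.{u} k) ℕ :=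
  CochainComplex.of (fun n => ModuleCat.of k (tensorOver k H X n))
    (fun n => ModuleCat.ofHom (extendedConnection k H X hX n))
    (fun n => ModuleCat.hom_ext (extendedConnection_comp hX n))

end CobarComplex

section CocyclicModules

/-- A cocyclic `k`-module: cofaces `δ n i : C^n → C^{n+1}` for `0 ≤ i ≤ n + 1`, codegeneracies
`σ n i : C^{n+1} → C^n` for `0 ≤ i ≤ n` and cyclic operators `τ n : C^n → C^n` subject to the
usual identities (the values for `i` out of these ranges play no role). -/
structure CocyclicModule (k : Type u) [CommRing k] where
  obj : ℕ → ModuleCat.{u} k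
  δ : (n : ℕ) → ℕ → (obj n →ₗ[k] obj (n + 1))
  σ : (n : ℕ) → ℕ → (obj (n + 1) →ₗ[k] obj n)
  τ : (n : ℕ) → (obj n →ₗ[k] obj n)
  δ_δ : ∀ n i j, i ≤ j → j ≤ n + 1 → δ (n + 1) (j + 1) ∘ₗ δ n i = δ (n + 1) i ∘ₗ δ n j
  σ_σ : ∀ n i j, i ≤ j → j ≤ n → σ n j ∘ₗ σ (n + 1) i = σ n i ∘ₗ σ (n + 1) (j + 1)
  σ_δ_of_le : ∀ n i j, i ≤ j → j ≤ n → σ (n + 1) (j + 1) ∘ₗ δ (n + 1) i = δ n i ∘ₗ σ n j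
  σ_δ_self : ∀ n i, i ≤ n → σ n i ∘ₗ δ n i = LinearMap.id
  σ_δ_succ : ∀ n i, i ≤ n → σ n i ∘ₗ δ n (i + 1) = LinearMap.id
  σ_δ_of_gt : ∀ n i j, j < i → i ≤ n + 1 → σ (n + 1) j ∘ₗ δ (n + 1) (i + 1) = δ n i ∘ₗ σ n j
  τ_δ_zero : ∀ n, τ (n + 1) ∘ₗ δ n 0 = δ n (n + 1)
  τ_δ_succ : ∀ n i, i ≤ n → τ (n + 1) ∘ₗ δ n (i + 1) = δ n i ∘ₗ τ n
  τ_σ_zero : ∀ n, τ n ∘ₗ σ n 0 = σ n n ∘ₗ τ (n + 1) ∘ₗ τ (n + 1)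
  τ_σ_succ : ∀ n i, i + 1 ≤ n → τ n ∘ₗ σ n (i + 1) = σ n i ∘ₗ τ (n + 1)
  τ_pow : ∀ n, τ n ^ (n + 1) = 1

theorem sum_sum_eq_zero_of_simplicial {A : Type u} [AddCommGroup A] (f : ℕ → ℕ → A) (N : ℕ)
    (hf : ∀ i j, i ≤ j → j < N → f (j + 1) i = f i j) :
    ∑ j ∈ Finset.range (N + 1), ∑ i ∈ Finset.range N, (-1 : ℤ) ^ j • (-1 : ℤ) ^ i • f j i = 0 := by
  induction N with
  | zero => simp
  | succ N ih =>
    have ih := ih (fun i j h1 h2 => hf i j h1 (by omega))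
    rw [Finset.sum_range_succ, Finset.sum_congr rfl (fun j _ => Finset.sum_range_succ
      (fun i => (-1 : ℤ) ^ j • (-1 : ℤ) ^ i • f j i) N), Finset.sum_add_distrib, ih, zero_add,
      ← Finset.sum_add_distrib]
    refine Finset.sum_eq_zero fun i hi => ?_
    rw [hf i N (by simpa [Nat.lt_succ_iff] using hi) (by omega), pow_succ, smul_comm]
    simp

namespace CocyclicModule

variable {k : Type u} [CommRing k] (C : CocyclicModule k)

/-- The Hochschild coboundary `b = ∑_{i ≤ n + 1} (-1)^i δ_i`. -/
def b (n : ℕ) : C.obj n →ₗ[k] C.obj (n + 1) :=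
  ∑ i ∈ Finset.range (n + 2), (-1 : ℤ) ^ i • C.δ n i

theorem b_comp_b (n : ℕ) : C.b (n + 1) ∘ₗ C.b n = 0 := by
  refine LinearMap.ext fun x => ?_
  have := sum_sum_eq_zero_of_simplicial (fun j i => C.δ (n + 1) j (C.δ n i x)) (n + 2)
    (fun i j h1 h2 => LinearMap.congr_fun (C.δ_δ n i j h1 (by omega)) x)
  simpa [b, Finset.smul_sum] using this

/-- The Hochschild complex of a cocyclic module. -/
def hochschildComplex : CochainComplex (ModuleCat.{u} k) ℕ :=
  CochainComplex.of C.obj (fun n => ModuleCat.ofHom (C.b n))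
    (fun n => ModuleCat.hom_ext (C.b_comp_b n))

end CocyclicModule

end CocyclicModules

section HopfCyclic

open tensorPow

variable {k : Type u} [CommRing k] {H : Type u} [Ring H] [HopfAlgebra k H]
variable {X : Type u} [AddCommGroup X] [Module k X] 

namespace hopfCyclic

section Operators

variable [LeftComodule k H X]

/-- `c₁ ⊗ ⋯ ⊗ cₙ ⊗ x, c₀ ↦ c₁ ⊗ ⋯ ⊗ cₙ ⊗ x₍₋₁₎ c₀ ⊗ x₍₀₎`. -/
def append (n : ℕ) : tensorPow k H X n →ₗ[k] H →ₗ[k] tensorPow k H X (n + 1) :=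
  onLast (LinearMap.mk₂ k (fun x c => (LinearMap.mulRight k c).rTensor X (LeftComodule.coact x))
    (by intros; simp) (by intros; simp)
    (by
      intro x c c'
      induction LeftComodule.coact (k := k) (C := H) x using TensorProduct.induction_on with
      | zero => simp
      | add x y hx hy =>
        simp only [map_add, hx, hy]
        abel
      | tmul a y => simp [mul_add, TensorProduct.add_tmul])
    (by
      intro r x c
      induction LeftComodule.coact (k := k) (C := H) x using TensorProduct.induction_on with
      | zero => simp
      | add x y hx hy => simp only [map_add, hx, hy, smul_add]
      | tmul a y => simp [TensorProduct.smul_tmul'])) n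

theorem append_base (x : X) (c : H) : append 0 (base x : tensorPow k H X 0) c =
    one ((LinearMap.mulRight k c).rTensor X (LeftComodule.coact x)) := rfl

@[simp]
theorem append_cons (n : ℕ) (h : H) (w : tensorPow k H X n) (c : H) :
    append (n + 1) (cons h w) c = cons h (append n w c) := onLast_cons _ n h w c

/-- The operator `c₀ ⊗ ⋯ ⊗ cₙ ⊗ x ↦ c₁ ⊗ ⋯ ⊗ cₙ ⊗ x₍₋₁₎ c₀ ⊗ x₍₀₎`. -/
def rotate (n : ℕ) : tensorPow k H X (n + 1) →ₗ[k] tensorPow k H X (n + 1) :=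
  uncons (append n).flip

@[simp]
theorem rotate_cons (n : ℕ) (c : H) (w : tensorPow k H X n) :
    rotate n (cons c w) = append n w c := by
  simp [rotate]

/-- The coface operators on `H^{⊗ (n+1)} ⊗ X`: for `i ≤ n`
`c₀ ⊗ ⋯ ⊗ cₙ ⊗ x ↦ c₀ ⊗ ⋯ ⊗ cᵢ₍₁₎ ⊗ cᵢ₍₂₎ ⊗ ⋯ ⊗ cₙ ⊗ x`, and for `i = n + 1`
`c₀ ⊗ ⋯ ⊗ cₙ ⊗ x ↦ c₀₍₂₎ ⊗ c₁ ⊗ ⋯ ⊗ cₙ ⊗ x₍₋₁₎ c₀₍₁₎ ⊗ x₍₀₎`. -/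
def preδ (n i : ℕ) : tensorPow k H X (n + 1) →ₗ[k] tensorPow k H X (n + 2) :=
  if i ≤ n then coface LeftComodule.coact (n + 1) i
  else rotate (n + 1) ∘ₗ coface LeftComodule.coact (n + 1) 0

theorem preδ_of_le {n i : ℕ} (h : i ≤ n) :
    preδ (k := k) (H := H) (X := X) n i = coface LeftComodule.coact (n + 1) i := if_pos h

theorem preδ_last (n : ℕ) : preδ (k := k) (H := H) (X := X) n (n + 1) =
    rotate (n + 1) ∘ₗ coface LeftComodule.coact (n + 1) 0 := if_neg (by omega)

/-- The codegeneracies `c₀ ⊗ ⋯ ⊗ cₙ₊₁ ⊗ x ↦ ε(cᵢ₊₁) c₀ ⊗ ⋯ ⊗ cᵢ ⊗ cᵢ₊₂ ⊗ ⋯ ⊗ cₙ₊₁ ⊗ x`. -/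
def preσ (n i : ℕ) : tensorPow k H X (n + 2) →ₗ[k] tensorPow k H X (n + 1) :=
  codegen (n + 1) (i + 1)

theorem coface_coface (ρ : X →ₗ[k] H ⊗[k] X) (m i j : ℕ) (hij : i ≤ j) (hj : j < m) :
    coface ρ (m + 1) (j + 1) ∘ₗ coface ρ m i = coface ρ (m + 1) i ∘ₗ coface ρ m j := by
  induction m generalizing i j with
  | zero => omega
  | succ m ih =>
    refine tensorPow.hom_ext fun h w => ?_
    simp only [LinearMap.comp_apply]
    rcases i with _ | i
    · rcases j with _ | j
      · rw [coface_cons_zero, coface_coassoc]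
      · rw [coface_cons_zero, coface_cons_succ, coface_cons_zero]
        induction Coalgebra.comul (R := k) h using TensorProduct.induction_on with
        | zero => simp
        | add x y hx hy => simp only [map_add, LinearMap.add_apply, hx, hy]
        | tmul a b => simp
    · rcases j with _ | j
      · omega
      · have := LinearMap.congr_fun (ih i j (by omega) (by omega)) w
        simp only [LinearMap.comp_apply] at this
        simp only [coface_cons_succ, this]

theorem append_coface (m i : ℕ) (hi : i < m) (w : tensorPow k H X m) (c : H) :
    append (m + 1) (coface LeftComodule.coact m i w) c =
      coface LeftComodule.coact (m + 1) i (append m w c) := by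
  induction m generalizing i with
  | zero => omega
  | succ m ih =>
    induction w using tensorPow.induction with
    | ha x y hx hy => simp only [map_add, LinearMap.add_apply, hx, hy]
    | hc h w =>
      rcases i with _ | i
      · rw [coface_cons_zero, append_cons, coface_cons_zero]
        induction Coalgebra.comul (R := k) h using TensorProduct.induction_on with
        | zero => simp
        | add x y hx hy => simp only [map_add, LinearMap.add_apply, hx, hy]
        | tmul a b => simp
      · simp only [coface_cons_succ, append_cons, ih i (by omega) w]

/-- `c₁ ⊗ c₂ ↦ append (append w c₁) c₂`. -/
def append₂ (m : ℕ) (w : tensorPow k H X m) : H ⊗[k] H →ₗ[k] tensorPow k H X (m + 2) :=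
  TensorProduct.lift (append (m + 1) ∘ₗ append m w)

theorem rotate_rotate_cons₂ (m : ℕ) (w : tensorPow k H X m) (s : H ⊗[k] H) :
    rotate (m + 1) (rotate (m + 1) (cons₂ s w)) = append₂ m w s := by
  induction s using TensorProduct.induction_on with
  | zero => simp
  | add x y hx hy => simp only [map_add, LinearMap.add_apply, hx, hy]
  | tmul a b => simp [append₂]

theorem append₂_cons (m : ℕ) (h : H) (w : tensorPow k H X m) (s : H ⊗[k] H) :
    append₂ (m + 1) (cons h w) s = cons h (append₂ m w s) := by
  induction s using TensorProduct.induction_on with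
  | zero => simp
  | add x y hx hy => simp only [map_add, hx, hy]
  | tmul a b => simp [append₂]

/-- `a ⊗ (b ⊗ y) ↦ a ⊗ b ⊗ y`. -/
def two : H ⊗[k] (H ⊗[k] X) →ₗ[k] tensorPow k H X 2 :=
  TensorProduct.lift (LinearMap.mk₂ k (fun a s => cons a (one s))
    (by intros; simp) (by intros; simp) (by intros; simp) (by intros; simp))

theorem coface_append (m : ℕ) (w : tensorPow k H X m) (c : H) :
    coface LeftComodule.coact (m + 1) m (append m w c) =
      append₂ m w (Coalgebra.comul (R := k) c) := by
  induction m with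
  | succ m ih =>
    induction w using tensorPow.induction with
    | ha x y hx hy =>
      have : ∀ s : H ⊗[k] H, append₂ (m + 1) (x + y) s =
          append₂ (m + 1) x s + append₂ (m + 1) y s := by
        intro s
        induction s using TensorProduct.induction_on with
        | zero => simp
        | add x y hx hy =>
          simp only [map_add, hx, hy]
          abel
        | tmul a b => simp [append₂]
      simp only [map_add, LinearMap.add_apply, hx, hy, this]
    | hc h w => rw [append_cons, coface_cons_succ, ih, append₂_cons]
  | zero =>
    induction w using tensorPow.induction_zero with
    | h x =>
    have key := LinearMap.congr_fun (LeftComodule.coassoc (k := k) (C := H) (X := X)) x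
    simp only [LinearMap.comp_apply] at key
    rw [append_base]
    let R : H ⊗[k] H →ₗ[k] (H ⊗[k] (H ⊗[k] X) →ₗ[k] H ⊗[k] (H ⊗[k] X)) :=
      TensorProduct.lift (LinearMap.mk₂ k (fun c d => TensorProduct.map (LinearMap.mulRight k c)
        ((LinearMap.mulRight k d).rTensor X))
        (by intros; ext; simp [mul_add, TensorProduct.add_tmul])
        (by intros; ext; simp [TensorProduct.smul_tmul'])
        (by intros; ext; simp [mul_add, TensorProduct.add_tmul, TensorProduct.tmul_add])
        (by
          intro r c d
          refine TensorProduct.ext_threefold' fun a b x => ?_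
          simp only [TensorProduct.map_tmul, LinearMap.rTensor_tmul, LinearMap.mulRight_apply,
            LinearMap.smul_apply, mul_smul_comm]
          rw [← TensorProduct.smul_tmul' r (b * d) x, TensorProduct.tmul_smul]))
    have hR : ∀ c d : H, R (c ⊗ₜ d) = TensorProduct.map (LinearMap.mulRight k c)
        ((LinearMap.mulRight k d).rTensor X) := fun c d => by simp [R]
    have h1 : ∀ (s t : H ⊗[k] H) (y : X), cons₂ (s * t) (base y) =
        two (R t (TensorProduct.assoc k H H X (s ⊗ₜ y))) := by
      intro s t y
      induction s using TensorProduct.induction_on with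
      | zero => simp
      | add u v hu hv =>
        simp only [map_add, add_mul, LinearMap.add_apply, TensorProduct.add_tmul, hu, hv]
      | tmul a b =>
      induction t using TensorProduct.induction_on with
      | zero => simp
      | add u v hu hv => simp only [map_add, mul_add, LinearMap.add_apply, hu, hv]
      | tmul a b => simp [hR, two]
    have h2 : ∀ s : H ⊗[k] X, coface LeftComodule.coact 1 0
        (one ((LinearMap.mulRight k c).rTensor X s)) = two (R (Coalgebra.comul (R := k) c)
          (TensorProduct.assoc k H H X ((Coalgebra.comul (R := k) (A := H)).rTensor X s))) := by
      intro s
      induction s using TensorProduct.induction_on with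
      | zero => simp
      | add u v hu hv => simp only [map_add, hu, hv]
      | tmul a y =>
        rw [LinearMap.rTensor_tmul, one_tmul, coface_cons_zero, LinearMap.mulRight_apply,
          Bialgebra.comul_mul, h1, LinearMap.rTensor_tmul]
    have h3 : ∀ t : H ⊗[k] H, append₂ 0 (base x) t =
        two (R t (LeftComodule.coact.lTensor H (LeftComodule.coact x))) := by
      intro t
      induction t using TensorProduct.induction_on with
      | zero => simp
      | add u v hu hv => simp only [map_add, LinearMap.add_apply, hu, hv]
      | tmul c d =>
        rw [hR]
        simp only [append₂, TensorProduct.lift.tmul, LinearMap.comp_apply, append_base]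
        induction LeftComodule.coact (k := k) (C := H) x using TensorProduct.induction_on with
        | zero => simp
        | add u v hu hv => simp only [map_add, LinearMap.add_apply, hu, hv]
        | tmul a y => simp [append_base, two]
    rw [h2, h3]
    exact congrArg (fun z => two (R (Coalgebra.comul (R := k) c) z)) key

theorem codegen_append_last (m : ℕ) (w : tensorPow k H X m) (c : H) :
    codegen m m (append m w c) = Coalgebra.counit (R := k) c • w := by
  induction m with
  | succ m ih =>
    induction w using tensorPow.induction with
    | ha x y hx hy => simp only [map_add, LinearMap.add_apply, hx, hy, smul_add]
    | hc h w => rw [append_cons, codegen_cons_succ, ih, map_smul]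
  | zero =>
    induction w using tensorPow.induction_zero with
    | h x =>
    have key := LinearMap.congr_fun (LeftComodule.counit_coact (k := k) (C := H) (X := X)) x
    simp only [LinearMap.comp_apply, LinearMap.id_apply] at key
    rw [append_base]
    have : ∀ s : H ⊗[k] X, codegen 0 0 (one ((LinearMap.mulRight k c).rTensor X s)) =
        Coalgebra.counit (R := k) c • base (k := k) (H := H) ((TensorProduct.lid k X).toLinearMap
          ((Coalgebra.counit (R := k) (A := H)).rTensor X s)) := by
      intro s
      induction s using TensorProduct.induction_on with
      | zero => simp
      | add u v hu hv => simp only [map_add, hu, hv, smul_add]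
      | tmul a y => simp [mul_comm, mul_smul]
    rw [this, key]

theorem append_codegen (m i : ℕ) (hi : i ≤ m) (w : tensorPow k H X (m + 1)) (c : H) :
    append m (codegen m i w) c = codegen (m + 1) i (append (m + 1) w c) := by
  induction m generalizing i with
  | zero =>
    induction w using tensorPow.induction with
    | ha x y hx hy => simp only [map_add, LinearMap.add_apply, hx, hy]
    | hc h w =>
      obtain rfl : i = 0 := by omega
      simp
  | succ m ih =>
    induction w using tensorPow.induction with
    | ha x y hx hy => simp only [map_add, LinearMap.add_apply, hx, hy]
    | hc h w =>
      rcases i with _ | i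
      · simp
      · rw [codegen_cons_succ, append_cons, append_cons, codegen_cons_succ, ih i (by omega)]

theorem codegen_codegen (m i j : ℕ) (hij : i ≤ j) (hj : j ≤ m) :
    codegen (k := k) (H := H) (M := X) m j ∘ₗ codegen (m + 1) i =
      codegen m i ∘ₗ codegen (m + 1) (j + 1) := by
  induction m generalizing i j with
  | zero =>
    refine tensorPow.hom_ext fun h w => ?_
    obtain rfl : j = 0 := by omega
    obtain rfl : i = 0 := by omega
    simp
  | succ m ih =>
    refine tensorPow.hom_ext fun h w => ?_
    rcases i with _ | i
    · simp
    · rcases j with _ | j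
      · omega
      · have := LinearMap.congr_fun (ih i j (by omega) (by omega)) w
        simp only [LinearMap.comp_apply] at this
        simp only [LinearMap.comp_apply, codegen_cons_succ, this]

theorem codegen_coface_self (ρ : X →ₗ[k] H ⊗[k] X) (m i : ℕ) (hi : i < m) :
    codegen m i ∘ₗ coface ρ m i = LinearMap.id := by
  induction m generalizing i with
  | zero => omega
  | succ m ih =>
    refine tensorPow.hom_ext fun h w => ?_
    rcases i with _ | i
    · have key := Coalgebra.rTensor_counit_comul (R := k) h
      have : ∀ s : H ⊗[k] H, codegen (m + 1) 0 (cons₂ s w) = cons (TensorProduct.lid k H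
          ((Coalgebra.counit (R := k) (A := H)).rTensor H s)) w := by
        intro s
        induction s using TensorProduct.induction_on with
        | zero => simp
        | add u v hu hv => simp only [map_add, LinearMap.add_apply, hu, hv]
        | tmul a y => simp
      simp [this]
    · have := LinearMap.congr_fun (ih i (by omega)) w
      simp only [LinearMap.comp_apply] at this
      simp [this]

theorem codegen_coface_succ (ρ : X →ₗ[k] H ⊗[k] X) (m i : ℕ) (hi : i < m) :
    codegen m (i + 1) ∘ₗ coface ρ m i = LinearMap.id := by
  induction m generalizing i with
  | zero => omega
  | succ m ih =>
    refine tensorPow.hom_ext fun h w => ?_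
    rcases i with _ | i
    · have key := Coalgebra.lTensor_counit_comul (R := k) h
      have : ∀ s : H ⊗[k] H, codegen (m + 1) 1 (cons₂ s w) = cons (TensorProduct.rid k H
          ((Coalgebra.counit (R := k) (A := H)).lTensor H s)) w := by
        intro s
        induction s using TensorProduct.induction_on with
        | zero => simp
        | add u v hu hv => simp only [map_add, LinearMap.add_apply, hu, hv]
        | tmul a y => simp
      simp [this]
    · have := LinearMap.congr_fun (ih i (by omega)) w
      simp only [LinearMap.comp_apply] at this
      simp [this]

theorem codegen_coface_of_lt (ρ : X →ₗ[k] H ⊗[k] X) (m i j : ℕ) (hij : i < j) (hj : j ≤ m) :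
    codegen (m + 1) (j + 1) ∘ₗ coface ρ (m + 1) i = coface ρ m i ∘ₗ codegen m j := by
  induction m generalizing i j with
  | zero => omega
  | succ m ih =>
    refine tensorPow.hom_ext fun h w => ?_
    rcases j with _ | j
    · omega
    rcases i with _ | i
    · simp only [LinearMap.comp_apply, codegen_cons_succ, coface_cons_zero]
      induction Coalgebra.comul (R := k) h using TensorProduct.induction_on with
      | zero => simp
      | add u v hu hv => simp only [map_add, LinearMap.add_apply, hu, hv]
      | tmul a y => simp
    · have := LinearMap.congr_fun (ih i j (by omega) (by omega)) w
      simp only [LinearMap.comp_apply] at this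
      simp [this]

theorem codegen_coface_of_ge (ρ : X →ₗ[k] H ⊗[k] X) (m i j : ℕ) (hij : j ≤ i) (hi : i < m) :
    codegen (m + 1) j ∘ₗ coface ρ (m + 1) (i + 1) = coface ρ m i ∘ₗ codegen m j := by
  induction m generalizing i j with
  | zero => omega
  | succ m ih =>
    refine tensorPow.hom_ext fun h w => ?_
    rcases j with _ | j
    · simp
    rcases i with _ | i
    · omega
    · have := LinearMap.congr_fun (ih i j (by omega) (by omega)) w
      simp only [LinearMap.comp_apply] at this
      simp [this]

theorem rotate_coface_succ (n i : ℕ) (hi : i < n) :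
    rotate (k := k) (H := H) (X := X) (n + 1) ∘ₗ coface LeftComodule.coact (n + 1) (i + 1) =
      coface LeftComodule.coact (n + 1) i ∘ₗ rotate n :=
  tensorPow.hom_ext fun c w => by simp [append_coface n i hi]

theorem rotate_rotate_coface_zero (n : ℕ) :
    rotate (k := k) (H := H) (X := X) (n + 1) ∘ₗ rotate (n + 1) ∘ₗ
      coface LeftComodule.coact (n + 1) 0 = coface LeftComodule.coact (n + 1) n ∘ₗ rotate n :=
  tensorPow.hom_ext fun c w => by simp [coface_append, rotate_rotate_cons₂]

theorem rotate_preδ_zero (n : ℕ) :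
    rotate (k := k) (H := H) (X := X) (n + 1) ∘ₗ preδ n 0 = preδ n (n + 1) := by
  rw [preδ_last, preδ_of_le (by omega)]

theorem rotate_preδ_succ (n i : ℕ) (hi : i ≤ n) :
    rotate (k := k) (H := H) (X := X) (n + 1) ∘ₗ preδ n (i + 1) = preδ n i ∘ₗ rotate n := by
  rcases hi.lt_or_eq with h | rfl
  · rw [preδ_of_le (by omega), preδ_of_le hi, rotate_coface_succ n i h]
  · rw [preδ_last, preδ_of_le hi, rotate_rotate_coface_zero]

theorem preδ_preδ (n i j : ℕ) (hij : i ≤ j) (hj : j ≤ n + 1) :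
    preδ (k := k) (H := H) (X := X) (n + 1) (j + 1) ∘ₗ preδ n i = preδ (n + 1) i ∘ₗ preδ n j := by
  have low : ∀ i j, i ≤ j → j ≤ n →
      preδ (k := k) (H := H) (X := X) (n + 1) (j + 1) ∘ₗ preδ n i = preδ (n + 1) i ∘ₗ preδ n j := by
    intro i j hij hj
    rw [preδ_of_le (by omega), preδ_of_le (by omega), preδ_of_le (by omega), preδ_of_le (by omega),
      coface_coface _ _ _ _ hij (by omega)]
  rcases hj.lt_or_eq with h | rfl
  · exact low i j hij (by omega)
  · rw [← rotate_preδ_zero, ← rotate_preδ_zero]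
    rcases hij.lt_or_eq with h | rfl
    · rw [LinearMap.comp_assoc, ← low 0 i (by omega) (by omega), ← LinearMap.comp_assoc,
        rotate_preδ_succ _ _ (by omega), LinearMap.comp_assoc]
    · rw [← LinearMap.comp_assoc (preδ n 0) (rotate (n + 1)), ← rotate_preδ_succ _ _ (by omega),
        ← rotate_preδ_zero, ← rotate_preδ_zero]
      rw [LinearMap.comp_assoc, LinearMap.comp_assoc, LinearMap.comp_assoc,
        ← low 0 0 le_rfl (by omega), ← LinearMap.comp_assoc (preδ n 0) (preδ (n + 1) (0 + 1)),
        rotate_preδ_succ _ _ (by omega), LinearMap.comp_assoc]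

theorem rotate_preσ_zero (n : ℕ) : rotate (k := k) (H := H) (X := X) n ∘ₗ preσ n 0 =
    preσ n n ∘ₗ rotate (n + 1) ∘ₗ rotate (n + 1) := by
  refine tensorPow.hom_ext fun c w => ?_
  induction w using tensorPow.induction with
  | ha x y hx hy => simp only [map_add, hx, hy]
  | hc h w =>
    simp only [preσ, LinearMap.comp_apply, codegen_cons_succ, codegen_cons_zero, rotate_cons,
      append_cons, codegen_append_last, map_smul]

theorem rotate_preσ_succ (n i : ℕ) (hi : i + 1 ≤ n) :
    rotate (k := k) (H := H) (X := X) n ∘ₗ preσ n (i + 1) = preσ n i ∘ₗ rotate (n + 1) := by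
  refine tensorPow.hom_ext fun c w => ?_
  simp only [preσ, LinearMap.comp_apply, codegen_cons_succ, rotate_cons, append_codegen n (i + 1) hi]

theorem preσ_preσ (n i j : ℕ) (hij : i ≤ j) (hj : j ≤ n) :
    preσ (k := k) (H := H) (X := X) n j ∘ₗ preσ (n + 1) i = preσ n i ∘ₗ preσ (n + 1) (j + 1) :=
  codegen_codegen (n + 1) (i + 1) (j + 1) (by omega) (by omega)

theorem preσ_preδ_of_le (n i j : ℕ) (hij : i ≤ j) (hj : j ≤ n) :
    preσ (k := k) (H := H) (X := X) (n + 1) (j + 1) ∘ₗ preδ (n + 1) i = preδ n i ∘ₗ preσ n j := by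
  rw [preδ_of_le (by omega), preδ_of_le (by omega)]
  exact codegen_coface_of_lt _ (n + 1) i (j + 1) (by omega) (by omega)

theorem preσ_preδ_self (n i : ℕ) (hi : i ≤ n) :
    preσ (k := k) (H := H) (X := X) n i ∘ₗ preδ n i = LinearMap.id := by
  rw [preδ_of_le hi]
  exact codegen_coface_succ _ (n + 1) i (by omega)

theorem preσ_preδ_succ (n i : ℕ) (hi : i ≤ n) :
    preσ (k := k) (H := H) (X := X) n i ∘ₗ preδ n (i + 1) = LinearMap.id := by
  rcases hi.lt_or_eq with h | rfl
  · rw [preδ_of_le (by omega)]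
    exact codegen_coface_self _ (n + 1) (i + 1) (by omega)
  · rw [preδ_last]
    refine tensorPow.hom_ext fun c w => ?_
    have : ∀ s : H ⊗[k] H, preσ i i (rotate (i + 1) (cons₂ s w)) = cons (TensorProduct.lid k H
        ((Coalgebra.counit (R := k) (A := H)).rTensor H s)) w := by
      intro s
      induction s using TensorProduct.induction_on with
      | zero => simp
      | add u v hu hv => simp only [map_add, LinearMap.add_apply, hu, hv]
      | tmul a y => simp [preσ, codegen_append_last]
    simp [this]

theorem preσ_preδ_of_gt (n i j : ℕ) (hij : j < i) (hi : i ≤ n + 1) :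
    preσ (k := k) (H := H) (X := X) (n + 1) j ∘ₗ preδ (n + 1) (i + 1) = preδ n i ∘ₗ preσ n j := by
  rcases hi.lt_or_eq with h | rfl
  · rw [preδ_of_le (by omega), preδ_of_le (by omega)]
    exact codegen_coface_of_ge _ (n + 1) i (j + 1) (by omega) (by omega)
  · rw [← rotate_preδ_zero, ← rotate_preδ_zero, ← LinearMap.comp_assoc,
      ← rotate_preσ_succ _ _ (by omega), LinearMap.comp_assoc, preσ_preδ_of_le _ _ _ (by omega)
      (by omega), LinearMap.comp_assoc]

end Operators

section Coinvariants

variable [Module H X] [IsScalarTower k H X]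

/-- The diagonal action on `H^{⊗ n} ⊗ X`:
`h (c₁ ⊗ ⋯ ⊗ cₙ ⊗ x) = h₍₁₎ c₁ ⊗ ⋯ ⊗ h₍ₙ₎ cₙ ⊗ h₍ₙ₊₁₎ x`. -/
def diagonal : (n : ℕ) → H →ₗ[k] tensorPow k H X n →ₗ[k] tensorPow k H X n
  | 0 => (LinearEquiv.conj (base (k := k) (H := H) (M := X))).toLinearMap ∘ₗ
      (Algebra.lsmul k k X).toLinearMap
  | n + 1 => TensorProduct.lift (LinearMap.mk₂ k
      (fun a b => uncons (LinearMap.mk₂ k (fun c w => cons (a * c) (diagonal n b w))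
        (by intros; simp [mul_add]) (by intros; simp) (by intros; simp) (by intros; simp)))
      (by intros; refine tensorPow.hom_ext fun c w => ?_; simp [add_mul])
      (by intros; refine tensorPow.hom_ext fun c w => ?_; simp)
      (by intros; refine tensorPow.hom_ext fun c w => ?_; simp)
      (by intros; refine tensorPow.hom_ext fun c w => ?_; simp)) ∘ₗ Coalgebra.comul

@[simp]
theorem diagonal_base (h : H) (x : X) :
    diagonal 0 h (base x : tensorPow k H X 0) = base (h • x) := rfl

/-- `a ⊗ b ↦ a c ⊗ b w` -/
def diagonalAux (n : ℕ) (c : H) (w : tensorPow k H X n) :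
    H ⊗[k] H →ₗ[k] tensorPow k H X (n + 1) :=
  TensorProduct.lift (LinearMap.mk₂ k (fun a b => cons (a * c) (diagonal n b w))
    (by intros; simp [add_mul]) (by intros; simp) (by intros; simp) (by intros; simp))

@[simp]
theorem diagonalAux_tmul (n : ℕ) (a b c : H) (w : tensorPow k H X n) :
    diagonalAux n c w (a ⊗ₜ b) = cons (a * c) (diagonal n b w) := by
  simp [diagonalAux]

theorem diagonal_cons (n : ℕ) (h c : H) (w : tensorPow k H X n) :
    diagonal (n + 1) h (cons c w) = diagonalAux n c w (Coalgebra.comul (R := k) h) := by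
  simp only [diagonal, LinearMap.comp_apply]
  induction Coalgebra.comul (R := k) h using TensorProduct.induction_on with
  | zero => simp
  | add u v hu hv => simp only [map_add, LinearMap.add_apply, hu, hv]
  | tmul a y => simp

end Coinvariants

end hopfCyclic

end HopfCyclic

section HopfCyclicObject

open tensorPow

variable {k : Type u} [CommRing k] {H : Type u} [Ring H] [HopfAlgebra k H]
variable {X : Type u} [AddCommGroup X] [Module k X] [Module H X] [IsScalarTower k H X]

namespace hopfCyclic

/-- `p ⊗ (q ⊗ r) ↦ (p ⊗ q) s ⊗ r w`. -/
def diagonalAux₂ (n : ℕ) (s : H ⊗[k] H) (w : tensorPow k H X n) :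
    H ⊗[k] (H ⊗[k] H) →ₗ[k] tensorPow k H X (n + 2) :=
  TensorProduct.lift (LinearMap.mk₂ k (fun t r => cons₂ (t * s) (diagonal n r w))
    (by intros; simp [add_mul]) (by intros; simp) (by intros; simp) (by intros; simp)) ∘ₗ
      (TensorProduct.assoc k H H H).symm.toLinearMap

theorem diagonalAux₂_tmul (n : ℕ) (s : H ⊗[k] H) (w : tensorPow k H X n) (t : H ⊗[k] H) (r : H) :
    diagonalAux₂ n s w (TensorProduct.assoc k H H H (t ⊗ₜ r)) =
      cons₂ (t * s) (diagonal n r w) := by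
  simp [diagonalAux₂]

theorem diagonal_cons₂ (n : ℕ) (h : H) (s : H ⊗[k] H) (w : tensorPow k H X n) :
    diagonal (n + 2) h (cons₂ s w) = diagonalAux₂ n s w
      ((Coalgebra.comul (R := k) (A := H)).lTensor H (Coalgebra.comul (R := k) h)) := by
  induction s using TensorProduct.induction_on with
  | zero =>
    have : diagonalAux₂ n (0 : H ⊗[k] H) w = 0 := by
      refine TensorProduct.ext_threefold' fun p q r => ?_
      simp [diagonalAux₂]
    simp [this]
  | add x y hx hy =>
    have : diagonalAux₂ n (x + y) w = diagonalAux₂ n x w + diagonalAux₂ n y w := by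
      refine TensorProduct.ext_threefold' fun p q r => ?_
      simp [diagonalAux₂, mul_add]
    simp only [map_add, LinearMap.add_apply, hx, hy, this]
  | tmul a b =>
    rw [cons₂_tmul, diagonal_cons]
    induction Coalgebra.comul (R := k) h using TensorProduct.induction_on with
    | zero => simp
    | add u v hu hv => simp only [map_add, hu, hv]
    | tmul p q =>
      rw [diagonalAux_tmul, diagonal_cons, LinearMap.lTensor_tmul]
      induction Coalgebra.comul (R := k) q using TensorProduct.induction_on with
      | zero => simp
      | add u v hu hv => simp only [map_add, hu, hv, TensorProduct.tmul_add]
      | tmul q r => simp [diagonalAux₂]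

theorem coface_diagonal (ρ : X →ₗ[k] H ⊗[k] X) (n i : ℕ) (hi : i < n) (h : H)
    (w : tensorPow k H X n) :
    coface ρ n i (diagonal n h w) = diagonal (n + 1) h (coface ρ n i w) := by
  induction n generalizing i h with
  | zero => omega
  | succ n ih =>
    induction w using tensorPow.induction with
    | ha x y hx hy => simp only [map_add, hx, hy]
    | hc c w =>
      rw [diagonal_cons]
      rcases i with _ | i
      · rw [coface_cons_zero, diagonal_cons₂, ← Coalgebra.coassoc_apply]
        induction Coalgebra.comul (R := k) h using TensorProduct.induction_on with
        | zero => simp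
        | add u v hu hv => simp only [map_add, hu, hv]
        | tmul p q =>
          rw [diagonalAux_tmul, coface_cons_zero, LinearMap.rTensor_tmul, diagonalAux₂_tmul,
            Bialgebra.comul_mul]
      · rw [coface_cons_succ, diagonal_cons]
        induction Coalgebra.comul (R := k) h using TensorProduct.induction_on with
        | zero => simp
        | add u v hu hv => simp only [map_add, hu, hv]
        | tmul p q => simp [ih i (by omega)]

theorem codegen_diagonal (n i : ℕ) (h : H) (w : tensorPow k H X (n + 1)) :
    codegen n i (diagonal (n + 1) h w) = diagonal n h (codegen n i w) := by
  induction n generalizing i h with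
  | zero =>
    induction w using tensorPow.induction with
    | ha x y hx hy => simp only [map_add, hx, hy]
    | hc c w =>
      rw [diagonal_cons]
      have : ∀ t : H ⊗[k] H, codegen 0 i (diagonalAux 0 c w t) = Coalgebra.counit (R := k) c •
          diagonal 0 (TensorProduct.lid k H
            ((Coalgebra.counit (R := k) (A := H)).rTensor H t)) w := by
        intro t
        induction t using TensorProduct.induction_on with
        | zero => simp
        | add u v hu hv => simp only [map_add, LinearMap.add_apply, smul_add, hu, hv]
        | tmul p q => simp [mul_comm, mul_smul]
      simp [this]
  | succ n ih =>
    induction w using tensorPow.induction with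
    | ha x y hx hy => simp only [map_add, hx, hy]
    | hc c w =>
      rw [diagonal_cons]
      rcases i with _ | i
      · have : ∀ t : H ⊗[k] H, codegen (n + 1) 0 (diagonalAux (n + 1) c w t) =
            Coalgebra.counit (R := k) c • diagonal (n + 1) (TensorProduct.lid k H
              ((Coalgebra.counit (R := k) (A := H)).rTensor H t)) w := by
          intro t
          induction t using TensorProduct.induction_on with
          | zero => simp
          | add u v hu hv => simp only [map_add, LinearMap.add_apply, smul_add, hu, hv]
          | tmul p q => simp [mul_comm, mul_smul]
        simp [this]
      · rw [codegen_cons_succ, diagonal_cons]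
        induction Coalgebra.comul (R := k) h using TensorProduct.induction_on with
        | zero => simp
        | add u v hu hv => simp only [map_add, hu, hv]
        | tmul p q => simp [ih i]

variable (k H X) in
/-- The relations `h v = ε(h) v` of the coinvariants `k ⊗_H (H^{⊗ n} ⊗ X)` of the diagonal
action. -/
def relations (n : ℕ) : Submodule k (tensorPow k H X n) :=
  Submodule.span k {z | ∃ (h : H) (v : tensorPow k H X n),
    z = diagonal n h v - Coalgebra.counit (R := k) h • v}

variable [LeftComodule k H X] [HasInvertibleAntipode k H]

/-- `p ⊗ q ↦ p (append w (S⁻¹(q) c))`. -/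
def appendAux (n : ℕ) (w : tensorPow k H X n) (c : H) :
    H ⊗[k] H →ₗ[k] tensorPow k H X (n + 1) :=
  TensorProduct.lift (LinearMap.mk₂ k
    (fun p q => diagonal (n + 1) p (append n w (antipodeInv k H q * c)))
    (by intros; simp) (by intros; simp) (by intros; simp [add_mul]) (by intros; simp))

theorem appendAux_tmul (n : ℕ) (w : tensorPow k H X n) (c p q : H) :
    appendAux n w c (p ⊗ₜ q) = diagonal (n + 1) p (append n w (antipodeInv k H q * c)) := by
  simp [appendAux]

theorem appendAux_add (n : ℕ) (w w' : tensorPow k H X n) (c : H) (t : H ⊗[k] H) :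
    appendAux n (w + w') c t = appendAux n w c t + appendAux n w' c t := by
  induction t using TensorProduct.induction_on with
  | zero => simp
  | add u v hu hv =>
    simp only [map_add, hu, hv]
    abel
  | tmul p q => simp [appendAux_tmul]

theorem append_diagonal (hX : IsAYD k H X) (n : ℕ) (h c : H) (w : tensorPow k H X n) :
    append n (diagonal n h w) c = appendAux n w c (Coalgebra.comul (R := k) h) := by
  induction n generalizing h with
  | zero =>
    induction w using tensorPow.induction_zero with
    | h x =>
    rw [diagonal_base, append_base, hX]
    let Ψ : H ⊗[k] (H ⊗[k] H) →ₗ[k] tensorPow k H X 1 :=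
      one.toLinearMap ∘ₗ (LinearMap.mulRight k c).rTensor X ∘ₗ
        (adAct₃ k H X).flip (LeftComodule.coact x)
    have h1 : ∀ t : H ⊗[k] H, appendAux 0 (base x) c t = Ψ (TensorProduct.assoc k H H H
        ((Coalgebra.comul (R := k) (A := H)).rTensor H t)) := by
      intro t
      induction t using TensorProduct.induction_on with
      | zero => simp
      | add u v hu hv => simp only [map_add, hu, hv]
      | tmul p q =>
        rw [appendAux_tmul, append_base, LinearMap.rTensor_tmul]
        simp only [Ψ, LinearMap.comp_apply, LinearMap.flip_apply]
        induction LeftComodule.coact (k := k) (C := H) x using TensorProduct.induction_on with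
        | zero => simp
        | add u v hu hv => simp only [map_add, hu, hv]
        | tmul g y =>
          rw [LinearMap.rTensor_tmul, one_tmul, diagonal_cons]
          induction Coalgebra.comul (R := k) p using TensorProduct.induction_on with
          | zero => simp
          | add u v hu hv =>
            simp only [map_add, TensorProduct.add_tmul, LinearMap.add_apply, hu, hv]
          | tmul p r => simp [adAct₃_tmul, mul_assoc]
    rw [h1, Coalgebra.coassoc_apply]
    rfl
  | succ n ih =>
    induction w using tensorPow.induction with
    | ha x y hx hy => simp only [map_add, LinearMap.add_apply, hx, hy, appendAux_add]
    | hc g w =>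
      let Φ : H ⊗[k] (H ⊗[k] H) →ₗ[k] tensorPow k H X (n + 2) :=
        TensorProduct.lift (LinearMap.mk₂ k (fun p t => cons (p * g) (appendAux n w c t))
          (by intros; simp [add_mul]) (by intros; simp) (by intros; simp) (by intros; simp))
      have h1 : ∀ t : H ⊗[k] H, append (n + 1) (diagonalAux n g w t) c =
          Φ ((Coalgebra.comul (R := k) (A := H)).lTensor H t) := by
        intro t
        induction t using TensorProduct.induction_on with
        | zero => simp
        | add u v hu hv => simp only [map_add, LinearMap.add_apply, hu, hv]
        | tmul p q => simp [ih, Φ]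
      have h2 : ∀ t : H ⊗[k] H, appendAux (n + 1) (cons g w) c t = Φ (TensorProduct.assoc k H H H
          ((Coalgebra.comul (R := k) (A := H)).rTensor H t)) := by
        intro t
        induction t using TensorProduct.induction_on with
        | zero => simp
        | add u v hu hv => simp only [map_add, hu, hv]
        | tmul p q =>
          rw [appendAux_tmul, append_cons, diagonal_cons, LinearMap.rTensor_tmul]
          induction Coalgebra.comul (R := k) p using TensorProduct.induction_on with
          | zero => simp
          | add u v hu hv => simp only [map_add, TensorProduct.add_tmul, hu, hv]
          | tmul p r => simp [Φ, appendAux_tmul]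
      rw [diagonal_cons, h1, h2, Coalgebra.coassoc_apply]

end hopfCyclic

end HopfCyclicObject

section HopfCyclicModule

open tensorPow

variable {k : Type u} [CommRing k] {H : Type u} [Ring H] [HopfAlgebra k H]
variable {X : Type u} [AddCommGroup X] [Module k X] [Module H X] [IsScalarTower k H X]

namespace hopfCyclic

section Iterate

variable [LeftComodule k H X]

/-- The transport along an equality of degrees. -/
def castDegree {a b : ℕ} (h : a = b) : tensorPow k H X a →ₗ[k] tensorPow k H X b := by
  subst h
  exact LinearMap.id

theorem castDegree_rfl {a : ℕ} (v : tensorPow k H X a) : castDegree rfl v = v := rfl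

theorem castDegree_cons {a b : ℕ} (h : a = b) (h' : a + 1 = b + 1) (c : H)
    (v : tensorPow k H X a) : castDegree h' (cons c v) = cons c (castDegree h v) := by
  subst h
  rfl

theorem castDegree_castDegree {a b c : ℕ} (h : a = b) (h' : b = c) (v : tensorPow k H X a) :
    castDegree h' (castDegree h v) = castDegree (h.trans h') v := by
  subst h h'
  rfl

/-- `c₁, …, cₙ, v ↦ c₁ ⊗ ⋯ ⊗ cₙ ⊗ v`. -/
def consList : (l : List H) → (m : ℕ) → tensorPow k H X m →ₗ[k] tensorPow k H X (m + l.length)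
  | [], _ => LinearMap.id
  | c :: l, m => cons c ∘ₗ consList l m

/-- The iterated application of `append` for the elements of a list. -/
def appendList : (l : List H) → (m : ℕ) → tensorPow k H X m →ₗ[k] tensorPow k H X (m + l.length)
  | [], _ => LinearMap.id
  | c :: l, m => castDegree (by rw [List.length_cons]; omega) ∘ₗ appendList l (m + 1) ∘ₗ
      (append m).flip c

theorem append_castDegree {a b : ℕ} (h : a = b) (h' : a + 1 = b + 1) (v : tensorPow k H X a)
    (c : H) : append b (castDegree h v) c = castDegree h' (append a v c) := by
  subst h
  rfl

theorem append_consList (l : List H) (m : ℕ) (v : tensorPow k H X m) (c : H)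
    (h : m + 1 + l.length = m + l.length + 1) :
    append (m + l.length) (consList l m v) c =
      castDegree h (consList l (m + 1) (append m v c)) := by
  induction l with
  | nil => rfl
  | cons d l ih =>
    change append (m + l.length + 1) (cons d (consList l m v)) c =
      castDegree h (cons d (consList l (m + 1) (append m v c)))
    rw [append_cons, ih (by omega)]
    exact (castDegree_cons (a := m + 1 + l.length) (b := m + l.length + 1) (by omega) h d _).symm

/-- The operator `rotate`, extended to degree `0`. -/
def rot : (n : ℕ) → tensorPow k H X n → tensorPow k H X n
  | 0 => id
  | n + 1 => rotate n

theorem iterate_rot_castDegree {a b : ℕ} (h : a = b) (j : ℕ) (v : tensorPow k H X a) :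
    (rot b)^[j] (castDegree h v) = castDegree h ((rot a)^[j] v) := by
  subst h
  rfl

theorem iterate_rot_consList (l : List H) (m : ℕ) (v : tensorPow k H X m) :
    (rot (m + l.length))^[l.length] (consList l m v) = appendList l m v := by
  induction l generalizing m with
  | nil => rfl
  | cons c l ih =>
    change (rot (m + (l.length + 1)))^[l.length + 1] (consList (c :: l) m v) = _
    rw [Function.iterate_succ_apply]
    have : rot (m + (l.length + 1)) (consList (c :: l) m v) =
        castDegree (by omega) (consList l (m + 1) (append m v c)) := by
      rw [← append_consList l m v c (by omega)]
      exact rotate_cons _ _ _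
    rw [this, iterate_rot_castDegree, ih]
    rfl

theorem appendList_cons (l : List H) (m : ℕ) (d : H) (v : tensorPow k H X m)
    (h : m + l.length + 1 = m + 1 + l.length) :
    appendList l (m + 1) (cons d v) = castDegree h (cons d (appendList l m v)) := by
  induction l generalizing m with
  | nil => rfl
  | cons c l ih =>
    simp only [appendList, LinearMap.comp_apply, LinearMap.flip_apply, append_cons]
    rw [ih (m + 1) _ (by omega), castDegree_castDegree]
    rw [← castDegree_cons (b := m + (l.length + 1)) _ (by omega)]
    rw [castDegree_castDegree]

theorem mem_span_consList (n : ℕ) (v : tensorPow k H X n) :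
    v ∈ Submodule.span k {z | ∃ (l : List H) (x : X) (h : 0 + l.length = n),
      z = castDegree h (consList l 0 (base x))} := by
  induction n with
  | zero => exact Submodule.subset_span ⟨[], v, rfl, rfl⟩
  | succ n ih =>
    induction v using tensorPow.induction with
    | ha x y hx hy => exact Submodule.add_mem _ hx hy
    | hc c w =>
      have := Submodule.mem_map_of_mem (f := cons c) (ih w)
      rw [Submodule.map_span] at this
      refine Submodule.span_mono ?_ this
      rintro _ ⟨_, ⟨l, x, h, rfl⟩, rfl⟩
      exact ⟨c :: l, x, by rw [List.length_cons]; omega, (castDegree_cons h _ c _).symm⟩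

theorem appendList_base (hs : IsStable k H X) (l : List H) (x : X) :
    appendList l 0 (base x) = TensorProduct.lift (diagonal (0 + l.length))
      ((consList l 0 ∘ₗ base.toLinearMap).lTensor H
        (LeftComodule.coact (k := k) (C := H) x)) := by
  induction l generalizing x with
  | nil =>
    have : ∀ s : H ⊗[k] X, TensorProduct.lift (diagonal 0)
        ((base (k := k) (H := H) (M := X)).toLinearMap.lTensor H s) =
          base (TensorProduct.lift (Algebra.lsmul k k X).toLinearMap s) := by
      intro s
      induction s using TensorProduct.induction_on with
      | zero => simp
      | add u v hu hv => simp only [map_add, hu, hv]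
      | tmul a y => simp
    exact ((this _).trans (congrArg base (hs x))).symm
  | cons c l ih =>
    have key := LinearMap.congr_fun (LeftComodule.coassoc (k := k) (C := H) (X := X)) x
    simp only [LinearMap.comp_apply] at key
    let Φ : H ⊗[k] (H ⊗[k] X) →ₗ[k] tensorPow k H X (0 + l.length + 1) :=
      uncons (cons ∘ₗ LinearMap.mulRight k c) ∘ₗ
        (TensorProduct.lift (diagonal (0 + l.length)) ∘ₗ
          (consList l 0 ∘ₗ base.toLinearMap).lTensor H).lTensor H
    have h1 : ∀ s : H ⊗[k] X, appendList l 1 (one ((LinearMap.mulRight k c).rTensor X s)) =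
        castDegree (by omega) (Φ (LeftComodule.coact.lTensor H s)) := by
      intro s
      induction s using TensorProduct.induction_on with
      | zero => simp
      | add u v hu hv => simp only [map_add, hu, hv]
      | tmul a y =>
        rw [LinearMap.rTensor_tmul, one_tmul, appendList_cons l 0 _ _ (by omega), ih y]
        rfl
    have h2 : ∀ s : H ⊗[k] X, TensorProduct.lift (diagonal (0 + l.length + 1))
        ((consList (c :: l) 0 ∘ₗ base.toLinearMap).lTensor H s) =
          Φ (TensorProduct.assoc k H H X ((Coalgebra.comul (R := k) (A := H)).rTensor X s)) := by
      intro s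
      induction s using TensorProduct.induction_on with
      | zero => simp
      | add u v hu hv => simp only [map_add, hu, hv]
      | tmul a y =>
        have : TensorProduct.lift (diagonal (0 + l.length + 1))
            ((consList (c :: l) 0 ∘ₗ base.toLinearMap).lTensor H (a ⊗ₜ[k] y)) =
            diagonalAux (0 + l.length) c (consList l 0 (base y)) (Coalgebra.comul (R := k) a) :=
          diagonal_cons _ _ _ _
        rw [this, LinearMap.rTensor_tmul]
        induction Coalgebra.comul (R := k) a using TensorProduct.induction_on with
        | zero => simp
        | add u v hu hv => simp only [map_add, TensorProduct.add_tmul, hu, hv]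
        | tmul p q =>
          rw [diagonalAux_tmul]
          exact (uncons_cons (cons ∘ₗ LinearMap.mulRight k c) p _).symm
    have h3 : appendList (c :: l) 0 (base x) = castDegree (by rw [List.length_cons]; omega)
        (appendList l 1 (one ((LinearMap.mulRight k c).rTensor X (LeftComodule.coact x)))) := rfl
    rw [h3, h1, castDegree_castDegree, castDegree_rfl, ← key]
    exact (h2 _).symm

end Iterate

/-- The projection of `H^{⊗ n} ⊗ X` onto its coinvariants. -/
abbrev mk (n : ℕ) : tensorPow k H X n →ₗ[k] tensorPow k H X n ⧸ relations k H X n :=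
  (relations k H X n).mkQ

theorem mk_diagonal (n : ℕ) (h : H) (v : tensorPow k H X n) :
    mk n (diagonal n h v) = Coalgebra.counit (R := k) h • mk n v := by
  rw [← map_smul]
  exact (Submodule.Quotient.eq _).2 (Submodule.subset_span ⟨h, v, rfl⟩)

theorem relations_le {n m : ℕ} (f : tensorPow k H X n →ₗ[k] tensorPow k H X m)
    (hf : ∀ (h : H) (v : tensorPow k H X n),
      mk m (f (diagonal n h v)) = Coalgebra.counit (R := k) h • mk m (f v)) :
    relations k H X n ≤ (relations k H X m).comap f := by
  refine Submodule.span_le.2 ?_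
  rintro _ ⟨h, v, rfl⟩
  have := hf h v
  rw [← map_smul, ← map_smul] at this
  have := (Submodule.Quotient.eq _).1 this
  rwa [← map_sub] at this

variable [LeftComodule k H X] [HasInvertibleAntipode k H]

theorem mk_appendAux (n : ℕ) (w : tensorPow k H X n) (c q : H) :
    mk (n + 1) (appendAux n w c (Coalgebra.comul (R := k) q)) =
      mk (n + 1) (append n w (antipodeInv k H q * c)) := by
  have : ∀ t : H ⊗[k] H, mk (n + 1) (appendAux n w c t) = mk (n + 1) (append n w
      (antipodeInv k H (TensorProduct.lid k H
        ((Coalgebra.counit (R := k) (A := H)).rTensor H t)) * c)) := by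
    intro t
    induction t using TensorProduct.induction_on with
    | zero => simp
    | add u v hu hv => simp only [map_add, add_mul, hu, hv]
    | tmul p q => rw [appendAux_tmul, mk_diagonal]; simp
  simp [this]

/-- `p ⊗ q ↦ S⁻¹(q) p`. -/
def twist : H ⊗[k] H →ₗ[k] H :=
  LinearMap.mul' k H ∘ₗ (antipodeInv k H).rTensor H ∘ₗ (TensorProduct.comm k H H).toLinearMap

theorem twist_comul (h : H) :
    twist (Coalgebra.comul (R := k) h) = algebraMap k H (Coalgebra.counit (R := k) h) := by
  apply HasInvertibleAntipode.bijective (k := k) (H := H).1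
  have : ∀ t : H ⊗[k] H, HopfAlgebra.antipode k (twist t) =
      LinearMap.mul' k H ((HopfAlgebra.antipode k (A := H)).rTensor H t) := by
    intro t
    induction t using TensorProduct.induction_on with
    | zero => simp
    | add u v hu hv => simp only [map_add, hu, hv]
    | tmul p q => simp [twist, HopfAlgebra.antipode_mul_antidistrib]
  rw [this, HopfAlgebra.mul_antipode_rTensor_comul_apply, Algebra.algebraMap_eq_smul_one, map_smul,
    HopfAlgebra.antipode_one]

theorem mk_rotate_diagonal (hX : IsAYD k H X) (n : ℕ) (h : H) (v : tensorPow k H X (n + 1)) :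
    mk (n + 1) (rotate n (diagonal (n + 1) h v)) =
      Coalgebra.counit (R := k) h • mk (n + 1) (rotate n v) := by
  induction v using tensorPow.induction with
  | ha x y hx hy => simp only [map_add, smul_add, hx, hy]
  | hc c w =>
    have : ∀ t : H ⊗[k] H, mk (n + 1) (rotate n (diagonalAux n c w t)) =
        mk (n + 1) (append n w (twist t * c)) := by
      intro t
      induction t using TensorProduct.induction_on with
      | zero => simp
      | add u v hu hv => simp only [map_add, add_mul, hu, hv]
      | tmul p q =>
        rw [diagonalAux_tmul, rotate_cons, append_diagonal hX, mk_appendAux]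
        simp [twist, mul_assoc]
    rw [diagonal_cons, this, twist_comul, rotate_cons, Algebra.algebraMap_eq_smul_one,
      smul_mul_assoc, one_mul, map_smul, map_smul]

theorem mk_preδ_diagonal (hX : IsAYD k H X) (n i : ℕ) (h : H) (v : tensorPow k H X (n + 1)) :
    mk (n + 2) (preδ n i (diagonal (n + 1) h v)) =
      Coalgebra.counit (R := k) h • mk (n + 2) (preδ n i v) := by
  unfold preδ
  split
  · rw [coface_diagonal _ _ _ (by omega), mk_diagonal]
  · rw [LinearMap.comp_apply, coface_diagonal _ _ _ (by omega), mk_rotate_diagonal hX]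
    rfl

theorem mk_preσ_diagonal (n i : ℕ) (h : H) (v : tensorPow k H X (n + 2)) :
    mk (n + 1) (preσ n i (diagonal (n + 2) h v)) =
      Coalgebra.counit (R := k) h • mk (n + 1) (preσ n i v) := by
  unfold preσ
  rw [codegen_diagonal, mk_diagonal]

theorem mk_iterate_rot (hs : IsStable k H X) (n : ℕ) (v : tensorPow k H X n) :
    mk n ((rot n)^[n] v) = mk n v := by
  induction mem_span_consList n v using Submodule.span_induction with
  | zero =>
    have h0 : ∀ j, (rot n)^[j] (0 : tensorPow k H X n) = 0 := fun j => by
      cases n with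
      | zero => exact Function.iterate_fixed rfl j
      | succ n => exact Function.iterate_fixed (map_zero (rotate n)) j
    rw [h0]
  | add x y _ _ hx hy =>
    have h0 : ∀ j, (rot n)^[j] (x + y) = (rot n)^[j] x + (rot n)^[j] y := fun j => by
      cases n with
      | zero => induction j with
        | zero => rfl
        | succ j ih => simp only [Function.iterate_succ_apply', ih]; rfl
      | succ n => exact Function.Semiconj₂.iterate (fun a b => map_add (rotate n) a b) j x y
    rw [h0, map_add, hx, hy, map_add]
  | smul r x _ hx =>
    have h0 : ∀ j, (rot n)^[j] (r • x) = r • (rot n)^[j] x := fun j => by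
      induction j with
      | zero => rfl
      | succ j ih =>
        simp only [Function.iterate_succ_apply', ih]
        cases n with
        | zero => rfl
        | succ n => exact map_smul (rotate n) r _
    rw [h0, map_smul, hx, map_smul]
  | mem z hz =>
    obtain ⟨l, x, rfl, rfl⟩ := hz
    rw [castDegree_rfl]
    have h1 : (rot (0 + l.length))^[0 + l.length] (consList l 0 (base x)) =
        (rot (0 + l.length))^[l.length] (consList (k := k) (X := X) l 0 (base x)) :=
      congrArg (fun j => (rot (0 + l.length))^[j] (consList l 0 (base x))) (Nat.zero_add _)
    rw [h1, iterate_rot_consList, appendList_base hs]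
    have h2 : ∀ s : H ⊗[k] X, mk _ (TensorProduct.lift (diagonal (0 + l.length))
        ((consList l 0 ∘ₗ base.toLinearMap).lTensor H s)) =
          mk _ (consList l 0 (base (TensorProduct.lid k X
            ((Coalgebra.counit (R := k) (A := H)).rTensor X s)))) := by
      intro s
      induction s using TensorProduct.induction_on with
      | zero => simp
      | add u v hu hv => simp only [map_add, hu, hv]
      | tmul a y =>
        rw [LinearMap.rTensor_tmul, TensorProduct.lid_tmul, map_smul, map_smul, map_smul]
        exact mk_diagonal _ _ _
    rw [h2]
    have key := LinearMap.congr_fun (LeftComodule.counit_coact (k := k) (C := H) (X := X)) x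
    exact congrArg (fun y => mk _ (consList l 0 (base y))) key

/-- The map induced on coinvariants. -/
def mapCoinvariants {n m : ℕ} (f : tensorPow k H X n →ₗ[k] tensorPow k H X m)
    (hf : relations k H X n ≤ (relations k H X m).comap f) :
    (tensorPow k H X n ⧸ relations k H X n) →ₗ[k] (tensorPow k H X m ⧸ relations k H X m) :=
  Submodule.mapQ _ _ f hf

end hopfCyclic

open hopfCyclic

variable [LeftComodule k H X] [HasInvertibleAntipode k H]

variable (k H X) in
/-- The Hopf-cyclic cocyclic module of `H` with coefficients in the stable anti-Yetter-Drinfeld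
module `X`: `C^n = k ⊗_H (H^{⊗ (n+1)} ⊗ X)`, the coinvariants of the diagonal action, with
* `δ_i [c₀ ⊗ ⋯ ⊗ cₙ ⊗ x] = [c₀ ⊗ ⋯ ⊗ cᵢ₍₁₎ ⊗ cᵢ₍₂₎ ⊗ ⋯ ⊗ cₙ ⊗ x]` for `i ≤ n`,
* `δ_{n+1} [c₀ ⊗ ⋯ ⊗ cₙ ⊗ x] = [c₀₍₂₎ ⊗ c₁ ⊗ ⋯ ⊗ cₙ ⊗ x₍₋₁₎ c₀₍₁₎ ⊗ x₍₀₎]`,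
* `σ_i [c₀ ⊗ ⋯ ⊗ cₙ₊₁ ⊗ x] = [c₀ ⊗ ⋯ ⊗ cᵢ ⊗ ε(cᵢ₊₁) ⊗ cᵢ₊₂ ⊗ ⋯ ⊗ cₙ₊₁ ⊗ x]`,
* `τ [c₀ ⊗ ⋯ ⊗ cₙ ⊗ x] = [c₁ ⊗ ⋯ ⊗ cₙ ⊗ x₍₋₁₎ c₀ ⊗ x₍₀₎]`. -/
def hopfCyclicModule (hX : IsAYD k H X) (hs : IsStable k H X) : CocyclicModule k where
  obj n := ModuleCat.of k (tensorPow k H X (n + 1) ⧸ relations k H X (n + 1))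
  δ n i := mapCoinvariants (preδ n i) (relations_le _ (mk_preδ_diagonal hX n i))
  σ n i := mapCoinvariants (preσ n i) (relations_le _ (mk_preσ_diagonal n i))
  τ n := mapCoinvariants (rotate n) (relations_le _ (mk_rotate_diagonal hX n))
  δ_δ n i j hij hj := Submodule.linearMap_qext _ (congrArg (mk _ ∘ₗ ·) (preδ_preδ n i j hij hj))
  σ_σ n i j hij hj := Submodule.linearMap_qext _ (congrArg (mk _ ∘ₗ ·) (preσ_preσ n i j hij hj))
  σ_δ_of_le n i j hij hj :=
    Submodule.linearMap_qext _ (congrArg (mk _ ∘ₗ ·) (preσ_preδ_of_le n i j hij hj))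
  σ_δ_self n i hi := Submodule.linearMap_qext _ (congrArg (mk _ ∘ₗ ·) (preσ_preδ_self n i hi))
  σ_δ_succ n i hi := Submodule.linearMap_qext _ (congrArg (mk _ ∘ₗ ·) (preσ_preδ_succ n i hi))
  σ_δ_of_gt n i j hij hi :=
    Submodule.linearMap_qext _ (congrArg (mk _ ∘ₗ ·) (preσ_preδ_of_gt n i j hij hi))
  τ_δ_zero n := Submodule.linearMap_qext _ (congrArg (mk _ ∘ₗ ·) (rotate_preδ_zero n))
  τ_δ_succ n i hi := Submodule.linearMap_qext _ (congrArg (mk _ ∘ₗ ·) (rotate_preδ_succ n i hi))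
  τ_σ_zero n := Submodule.linearMap_qext _ (congrArg (mk _ ∘ₗ ·) (rotate_preσ_zero n))
  τ_σ_succ n i hi := Submodule.linearMap_qext _ (congrArg (mk _ ∘ₗ ·) (rotate_preσ_succ n i hi))
  τ_pow n := by
    have h1 : ∀ (j : ℕ) (v : tensorPow k H X (n + 1)),
        (mapCoinvariants (rotate n) (relations_le _ (mk_rotate_diagonal hX n)) ^ j) (mk (n + 1) v) =
          mk (n + 1) ((rot (n + 1))^[j] v) := by
      intro j v
      induction j with
      | zero => rfl
      | succ j ih =>
        rw [pow_succ', Module.End.mul_apply, ih, Function.iterate_succ_apply']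
        rfl
    exact Submodule.linearMap_qext _ (LinearMap.ext fun v =>
      (h1 (n + 1) v).trans (mk_iterate_rot hs (n + 1) v))

end HopfCyclicModule

end

/-!
Everything is compared with the cobar complex of the comodule `X`, the `k`-modules `H^{⊗ n} ⊗ X`
with the differential `cobarD`; only the coaction enters in it.

* Moving the last factor of `K^n(H)` across `⊗_H` identifies `K^n(H) ⊗_H X` with `H^{⊗ n} ⊗ X`, and
  the extended connection becomes `cobarD` (`cobarIsoCalculus`).
* In the coinvariants of the diagonal action the first factor of `H^{⊗ (n+1)} ⊗ X` can be made `1`: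
  `w ↦ [1 ⊗ w]` is an isomorphism from `H^{⊗ n} ⊗ X` to the coinvariants, with inverse
  `[c ⊗ w] ↦ S(c) w`. It takes `cobarD` to `-b`, so that the signs `(-1)^n` turn it into an
  isomorphism of complexes (`cobarIsoHochschild`).
* The cobar complex computes `Cotor`. It is a functor `cobarFunctor` on left comodules, exact because
  `H` is flat (`cobarFunctor_map_shortExact`), its cohomology in degree `0` is `k □ -`
  (`cotensorIsoHomologyZero`), and it is acyclic in positive degrees on cofree comodules, where the
  counit provides a contracting homotopy, hence on injective comodules, which are retracts of
  cofree ones (`isZero_homology_of_injective`). An exact functor `G` to cochain complexes with this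
  vanishing property satisfies `R^n(H^0 ∘ G) = H^n ∘ G`, by dimension shifting along an injective
  resolution (`nonempty_rightDerived_iso`).
-/

noncomputable section

/-! ### Right derived functors from an exact functor to complexes -/

section DerivedFunctors

open HomologicalComplex

universe v₁ v₂ u₁ u₂

variable {A : Type u₁} [Category.{v₁} A] [Abelian A] {B : Type u₂} [Category.{v₂} B] [Abelian B]

/-- The short exact sequence `0 → Z^n → K^n → Z^{n+1} → 0` of a complex exact in degree `n + 1`. -/
theorem shortExact_cycles (K : CochainComplex A ℕ) (n : ℕ) (h : K.ExactAt (n + 1)) :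
    (ShortComplex.mk (K.iCycles n) (K.toCycles n (n + 1))
      (by rw [← cancel_mono (K.iCycles (n + 1))]; simp)).ShortExact := by
  have h' : (K.sc' n (n + 1) (n + 2)).Exact :=
    (K.exactAt_iff' n (n + 1) (n + 2) (by simp) (by simp)).1 h
  have hepi : Epi (K.toCycles n (n + 1)) := by
    have := h'.epi_toCycles
    rw [← K.toCycles_cyclesIsoSc'_hom n (n + 1) (n + 2) (by simp) (by simp)] at this
    exact (epi_comp_iff_of_isIso _ (K.cyclesIsoSc' n (n + 1) (n + 2) _ _).hom).1 this
  exact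
    { exact := by
        refine ShortComplex.exact_of_f_is_kernel _ (KernelFork.IsLimit.ofι' _ _ fun k hk => ?_)
        have hk' : k ≫ K.d n (n + 1) = 0 := by
          have := congrArg (· ≫ K.iCycles (n + 1)) hk
          simpa using this
        exact ⟨K.liftCycles k (n + 1) (by simp) hk', by simp⟩
      mono_f := inferInstanceAs (Mono (K.iCycles n))
      epi_g := hepi }

variable (G : A ⥤ CochainComplex B ℕ) [G.PreservesZeroMorphisms]
  (hG : ∀ S : ShortComplex A, S.ShortExact → (S.map G).ShortExact)
  (hI : ∀ (I : A) [Injective I] (n : ℕ), IsZero ((G.obj I).homology (n + 1)))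

include hG in
/-- `H^0 ∘ G` is left exact if `G` is exact, as `H^0` of a cochain complex in degrees `≥ 0` is left
exact. -/
theorem preservesFiniteLimits_of_iso_homology_zero (F : A ⥤ B) [F.Additive]
    (e : F ≅ G ⋙ homologyFunctor B (ComplexShape.up ℕ) 0) : PreservesFiniteLimits F := by
  rw [Functor.preservesFiniteLimits_iff_forall_exact_map_and_mono]
  intro S hS
  have hGS := hG S hS
  have hf : Mono (G.map S.f) := hGS.mono_f
  -- In degree `0` the homology consists of the cycles, and taking cycles preserves monomorphisms.
  have h1 : Mono (homologyMap (G.map S.f) 0) := by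
    have : Mono (homologyMap (G.map S.f) 0 ≫ (G.obj S.X₂).isoHomologyπ₀.inv) := by
      rw [CochainComplex.isoHomologyπ₀_inv_naturality]
      infer_instance
    exact mono_of_mono _ (G.obj S.X₂).isoHomologyπ₀.inv
  have h2 := hGS.homology_exact₂ 0
  refine ⟨(ShortComplex.exact_iff_of_iso (S.mapNatIso e)).2 h2, ?_⟩
  have : Mono (F.map S.f ≫ e.hom.app S.X₂) := by
    rw [e.hom.naturality]
    have : Mono ((G ⋙ homologyFunctor B (ComplexShape.up ℕ) 0).map S.f) := h1
    infer_instance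
  exact mono_of_mono _ (e.hom.app S.X₂)

include hG hI in
/-- Dimension shifting along the short exact sequences `0 → Z^q → I^q → Z^{q+1} → 0` of an exact
complex of injectives. -/
theorem nonempty_homology_cycles_iso (K : CochainComplex A ℕ) [∀ n, Injective (K.X n)]
    (hK : ∀ n, K.ExactAt (n + 1)) (n q : ℕ) :
    Nonempty ((G.obj (K.cycles q)).homology (n + 1) ≅ (G.obj (K.cycles (q + n))).homology 1) := by
  induction n generalizing q with
  | zero => exact ⟨Iso.refl _⟩
  | succ n ih =>
    obtain ⟨e⟩ := ih (q + 1)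
    rw [Nat.succ_add_eq_add_succ] at e
    exact ⟨((hG _ (shortExact_cycles K q (hK q))).δIso (n + 1) (n + 1 + 1) rfl
      (hI _ n) (hI _ (n + 1))).symm ≪≫ e⟩

include hG hI in
/-- Applying `T = H^0 ∘ G` to an exact complex `I^*` of injectives with cycles `Z^*` gives a complex
with `(n+1)`-st cohomology `H^1(G Z^n)`: left exactness of `T` makes `T(Z^{n+1})` its cycles, and the
connecting map `H^0(G Z^{n+1}) → H^1(G Z^n)` is a cokernel of `T(I^n) → T(Z^{n+1})` since
`H^1(G I^n) = 0`. -/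
theorem nonempty_homology_map_iso (T : A ⥤ B) [T.Additive]
    (e : T ≅ G ⋙ homologyFunctor B (ComplexShape.up ℕ) 0)
    (K : CochainComplex A ℕ) [∀ n, Injective (K.X n)] (hK : ∀ n, K.ExactAt (n + 1)) (n : ℕ) :
    Nonempty (((T.mapHomologicalComplex _).obj K).homology (n + 1) ≅
      (G.obj (K.cycles n)).homology 1) := by
  have := preservesFiniteLimits_of_iso_homology_zero G hG T e
  have hS := hG _ (shortExact_cycles K n (hK n))
  have hi : IsLimit (KernelFork.ofι (f := T.map (K.d (n + 1) (n + 2)))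
      (T.map (K.iCycles (n + 1)))
      (by rw [← T.map_comp, iCycles_d, T.map_zero])) :=
    isLimitForkMapOfIsLimit' T _ (K.cyclesIsKernel (n + 1) (n + 2) (by simp))
  let p : T.obj (K.cycles (n + 1)) ⟶ (G.obj (K.cycles n)).homology 1 :=
    e.hom.app _ ≫ hS.δ 0 1 rfl
  have hepi : Epi (hS.δ 0 1 rfl) := hS.epi_δ 0 1 rfl (hI _ 0)
  have hp0 : T.map (K.toCycles n (n + 1)) ≫ p = 0 := by
    have h0 : homologyMap (G.map (K.toCycles n (n + 1))) 0 ≫ hS.δ 0 1 rfl = 0 := hS.comp_δ 0 1 rfl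
    have h1 := e.hom.naturality_assoc (K.toCycles n (n + 1)) (hS.δ 0 1 rfl)
    exact h1.trans ((congrArg (e.hom.app _ ≫ ·) h0).trans comp_zero)
  have hp : (ShortComplex.mk (T.map (K.toCycles n (n + 1))) p hp0).Exact := by
    refine (ShortComplex.exact_iff_of_iso ?_).2 (hS.homology_exact₃ 0 1 rfl)
    exact ShortComplex.isoMk (e.app _) (e.app _) (Iso.refl _)
      (e.hom.naturality _).symm (Category.comp_id _).symm
  have hpe : Epi p := @epi_comp _ _ _ _ _ _ inferInstance _ hepi
  have hlift : hi.lift (KernelFork.ofι (T.map (K.d n (n + 1)))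
      (by rw [← T.map_comp, K.d_comp_d, T.map_zero])) = T.map (K.toCycles n (n + 1)) := by
    refine Fork.IsLimit.hom_ext hi ((hi.fac _ WalkingParallelPair.zero).trans ?_)
    change T.map _ = T.map _ ≫ T.map _
    rw [← T.map_comp, toCycles_i]
  let D : (((T.mapHomologicalComplex _).obj K).sc' n (n + 1) (n + 2)).LeftHomologyData :=
    { K := T.obj (K.cycles (n + 1))
      H := (G.obj (K.cycles n)).homology 1
      i := T.map (K.iCycles (n + 1))
      π := p
      wi := by
        change T.map _ ≫ T.map _ = 0
        rw [← T.map_comp, iCycles_d, T.map_zero]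
      hi := hi
      wπ := (congrArg (· ≫ p) hlift).trans hp0
      hπ := CokernelCofork.IsColimit.ofπ' p _ fun k hk =>
        ⟨hp.desc k ((congrArg (· ≫ k) hlift).symm.trans hk), hp.g_desc k _⟩ }
  exact ⟨((T.mapHomologicalComplex _).obj K).homologyIsoSc' n (n + 1) (n + 2) (by simp) (by simp)
    ≪≫ D.homologyIso⟩

include hG hI in
/-- The right derived functors of `H^0 ∘ G` for an exact functor `G` to cochain complexes such that
the complexes `G I` of injective objects `I` are acyclic in positive degrees. -/
theorem nonempty_rightDerived_iso [EnoughInjectives A] (T : A ⥤ B) [T.Additive]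
    (e : T ≅ G ⋙ homologyFunctor B (ComplexShape.up ℕ) 0) (X : A) (n : ℕ) :
    Nonempty ((T.rightDerived n).obj X ≅ (G.obj X).homology n) := by
  have := preservesFiniteLimits_of_iso_homology_zero G hG T e
  cases n with
  | zero => exact ⟨T.rightDerivedZeroIsoSelf.app X ≪≫ e.app X⟩
  | succ n =>
    let P := injectiveResolution X
    have hP : ∀ n, P.cocomplex.ExactAt (n + 1) := P.cocomplex_exactAt_succ
    obtain ⟨e₁⟩ := nonempty_homology_map_iso G hG hI T e P.cocomplex hP n
    obtain ⟨e₂⟩ := nonempty_homology_cycles_iso G hG hI P.cocomplex hP n 0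
    rw [Nat.zero_add] at e₂
    let e₃ : X ≅ P.cocomplex.cycles 0 :=
      P.isLimitKernelFork.conePointUniqueUpToIso (P.cocomplex.cyclesIsKernel 0 1 (by simp))
    exact ⟨P.isoRightDerivedObj T (n + 1) ≪≫ e₁ ≪≫ e₂.symm ≪≫
      (homologyFunctor B _ (n + 1)).mapIso (G.mapIso e₃.symm)⟩

end DerivedFunctors

/-! ### The calculus complex is the cobar complex -/

section CobarIso

open tensorPow calculus

/-- An isomorphism of cochain complexes given by isomorphisms in each degree which commute with the
differentials. -/
def cochainComplexOfIso {V : Type*} [Category V] [HasZeroMorphisms V] {C C' : ℕ → V}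
    {d : ∀ n, C n ⟶ C (n + 1)} {d' : ∀ n, C' n ⟶ C' (n + 1)} (h : ∀ n, d n ≫ d (n + 1) = 0)
    (h' : ∀ n, d' n ≫ d' (n + 1) = 0) (f : ∀ n, C n ≅ C' n)
    (hf : ∀ n, (f n).hom ≫ d' n = d n ≫ (f (n + 1)).hom) :
    CochainComplex.of C d h ≅ CochainComplex.of C' d' h' :=
  HomologicalComplex.Hom.isoOfComponents f (by
    rintro i _ rfl
    exact (congrArg ((f i).hom ≫ ·) (CochainComplex.of_d C' d' i)).trans
      ((hf i).trans (congrArg (· ≫ (f (i + 1)).hom) (CochainComplex.of_d C d i)).symm))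

variable {k : Type u} [CommRing k] {H : Type u} [Ring H] [HopfAlgebra k H]
variable {X : Type u} [AddCommGroup X] [Module k X] [LeftComodule k H X]

variable (k H X) in
/-- The cobar complex of a left comodule `X`: the `k`-modules `H^{⊗ n} ⊗ X` with the differential
`cobarD`. -/
def cobarComplex : CochainComplex (ModuleCat.{u} k) ℕ :=
  CochainComplex.of (fun n => ModuleCat.of k (tensorPow k H X n))
    (fun n => ModuleCat.ofHom (cobarD k H X n))
    (fun n => ModuleCat.hom_ext (LinearMap.ext (cobarD_cobarD n)))

theorem cobarComplex_d (n : ℕ) :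
    (cobarComplex k H X).d n (n + 1) = ModuleCat.ofHom (cobarD k H X n) :=
  CochainComplex.of_d (fun n => ModuleCat.of k (tensorPow k H X n))
    (fun n => ModuleCat.ofHom (cobarD k H X n)) n

variable [Module H X] [IsScalarTower k H X]

variable (k H X) in
/-- The map `K^n(H) → X → H^{⊗ n} ⊗ X`, `h⁰ ⊗ ⋯ ⊗ hⁿ, x ↦ h⁰ ⊗ ⋯ ⊗ h^{n-1} ⊗ hⁿ x`. -/
def actLast : (n : ℕ) → calculus k H n →ₗ[k] X →ₗ[k] tensorPow k H X n
  | 0 => (Algebra.lsmul k k X).toLinearMap.compr₂ base.toLinearMap ∘ₗ base.symm.toLinearMap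
  | n + 1 => uncons (LinearMap.mk₂ k (fun h w => cons h ∘ₗ actLast n w)
    (by intros; ext; simp) (by intros; ext; simp) (by intros; ext; simp) (by intros; ext; simp))

theorem actLast_base (g : H) (x : X) : actLast k H X 0 (base g) x = base (g • x) := rfl

theorem actLast_cons (n : ℕ) (h : H) (ω : calculus k H n) (x : X) :
    actLast k H X (n + 1) (cons h ω) x = cons h (actLast k H X n ω x) := by
  simp [actLast]

theorem actLast_rightMul (n : ℕ) (ω : calculus k H n) (h : H) (x : X) :
    actLast k H X n (rightMul h n ω) x = actLast k H X n ω (h • x) := by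
  induction n with
  | zero =>
    induction ω using tensorPow.induction_zero with
    | h g => rw [rightMul_base, actLast_base, actLast_base, mul_smul]
  | succ n ih =>
    induction ω using tensorPow.induction with
    | hc g w => rw [rightMul_cons, actLast_cons, actLast_cons, ih]
    | ha x y hx hy => simp only [map_add, LinearMap.add_apply, hx, hy]

variable [HasInvertibleAntipode k H]

variable (k H X) in
/-- The inverse `(w ⊗ h) ⊗_H x ↦ w ⊗ h x` of `ofCobar`. -/
def toCobar (n : ℕ) : tensorOver k H X n →ₗ[k] tensorPow k H X n :=
  liftOver n (actLast k H X n) (actLast_rightMul n)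

theorem toCobar_consOver (n : ℕ) (h : H) (z : tensorOver k H X n) :
    toCobar k H X (n + 1) (consOver h n z) = cons h (toCobar k H X n z) :=
  LinearMap.congr_fun (f := toCobar k H X (n + 1) ∘ₗ consOver h n)
    (g := cons h ∘ₗ toCobar k H X n) (hom_ext_over fun ω x => actLast_cons n h ω x) z

theorem toCobar_ofCobar (n : ℕ) (w : tensorPow k H X n) :
    toCobar k H X n (ofCobar n w) = w := by
  induction n with
  | zero =>
    induction w using tensorPow.induction_zero with
    | h x => exact congrArg (base (k := k) (H := H) (M := X)) (one_smul H x)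
  | succ n ih =>
    induction w using tensorPow.induction with
    | hc h w => rw [ofCobar_cons, toCobar_consOver, ih]
    | ha x y hx hy => rw [map_add, map_add, hx, hy]

variable (k H X) in
/-- The identification `H^{⊗ n} ⊗ X ≃ K^n(H) ⊗_H X`. -/
def cobarEquiv (n : ℕ) : tensorPow k H X n ≃ₗ[k] tensorOver k H X n :=
  LinearEquiv.ofBijective (ofCobar n)
    ⟨Function.LeftInverse.injective (g := toCobar k H X n) (toCobar_ofCobar n),
      ofCobar_surjective n⟩

variable (k H X) in
/-- The complex `K^*(H, X)` is the cobar complex of the comodule `X`. -/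
def cobarIsoCalculus (hX : IsAYD k H X) : cobarComplex k H X ≅ calculusComplex k H X hX :=
  cochainComplexOfIso (fun n => ModuleCat.hom_ext (LinearMap.ext (cobarD_cobarD n)))
    (fun n => ModuleCat.hom_ext (extendedConnection_comp hX n))
    (fun n => (cobarEquiv k H X n).toModuleIso)
    (fun n => ModuleCat.hom_ext (LinearMap.ext (extendedConnection_ofCobar hX n)))

end CobarIso

/-! ### The Hochschild complex of the Hopf-cyclic module is the cobar complex -/

section HochschildIso

open tensorPow hopfCyclic

variable {k : Type u} [CommRing k] {H : Type u} [Ring H] [HopfAlgebra k H]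
variable {X : Type u} [AddCommGroup X] [Module k X] [Module H X] [IsScalarTower k H X]

theorem diagonal_one (n : ℕ) (v : tensorPow k H X n) : diagonal n (1 : H) v = v := by
  induction n with
  | zero =>
    induction v using tensorPow.induction_zero with
    | h x => rw [diagonal_base, one_smul]
  | succ n ih =>
    induction v using tensorPow.induction with
    | ha x y hx hy => rw [map_add, hx, hy]
    | hc c w =>
      rw [diagonal_cons, Bialgebra.comul_one, Algebra.TensorProduct.one_def, diagonalAux_tmul, ih,
        one_mul]

theorem diagonal_mul (n : ℕ) (g h : H) (v : tensorPow k H X n) :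
    diagonal n (g * h) v = diagonal n g (diagonal n h v) := by
  induction n generalizing g h with
  | zero =>
    induction v using tensorPow.induction_zero with
    | h x => rw [diagonal_base, diagonal_base, diagonal_base, mul_smul]
  | succ n ih =>
    induction v using tensorPow.induction with
    | ha x y hx hy => rw [map_add, hx, hy, map_add, map_add]
    | hc c w =>
      rw [diagonal_cons, diagonal_cons, Bialgebra.comul_mul]
      induction Coalgebra.comul (R := k) h using TensorProduct.induction_on with
      | zero => simp
      | add x y hx hy => simp only [mul_add, map_add, hx, hy]
      | tmul a b =>
        rw [diagonalAux_tmul, diagonal_cons]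
        induction Coalgebra.comul (R := k) g using TensorProduct.induction_on with
        | zero => simp
        | add x y hx hy => simp only [add_mul, map_add, hx, hy]
        | tmul p q => rw [Algebra.TensorProduct.tmul_mul_tmul, diagonalAux_tmul, diagonalAux_tmul,
            ih, mul_assoc]

variable (k H X) in
/-- The map `c ⊗ w ↦ S(c) w` from `H^{⊗ (n+1)} ⊗ X` to `H^{⊗ n} ⊗ X`, for the diagonal action on
the target. -/
def antipodeAct (n : ℕ) : tensorPow k H X (n + 1) →ₗ[k] tensorPow k H X n :=
  uncons (diagonal n ∘ₗ HopfAlgebra.antipode k)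

theorem antipodeAct_cons (n : ℕ) (c : H) (w : tensorPow k H X n) :
    antipodeAct k H X n (cons c w) = diagonal n (HopfAlgebra.antipode k c) w :=
  uncons_cons _ c w

/-- `S(h₍₁₎ c) h₍₂₎ w = S(c) S(h₍₁₎) h₍₂₎ w = ε(h) S(c) w`. -/
theorem antipodeAct_diagonal (n : ℕ) (h : H) (v : tensorPow k H X (n + 1)) :
    antipodeAct k H X n (diagonal (n + 1) h v) =
      Coalgebra.counit (R := k) h • antipodeAct k H X n v := by
  induction v using tensorPow.induction with
  | ha x y hx hy => simp only [map_add, smul_add, hx, hy]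
  | hc c w =>
    have : ∀ t : H ⊗[k] H, antipodeAct k H X n (diagonalAux n c w t) =
        diagonal n (HopfAlgebra.antipode k c) (diagonal n
          (LinearMap.mul' k H ((HopfAlgebra.antipode k (A := H)).rTensor H t)) w) := by
      intro t
      induction t using TensorProduct.induction_on with
      | zero => simp
      | add u v hu hv => simp only [map_add, LinearMap.add_apply, hu, hv]
      | tmul p q =>
        simp [antipodeAct_cons, HopfAlgebra.antipode_mul_antidistrib, diagonal_mul]
    rw [diagonal_cons, this, HopfAlgebra.mul_antipode_rTensor_comul_apply, antipodeAct_cons,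
      Algebra.algebraMap_eq_smul_one, map_smul, LinearMap.smul_apply, diagonal_one, map_smul]

variable (k H X) in
/-- The map on coinvariants induced by `antipodeAct`. -/
def coinvariantsToCobar (n : ℕ) :
    (tensorPow k H X (n + 1) ⧸ relations k H X (n + 1)) →ₗ[k] tensorPow k H X n :=
  (relations k H X (n + 1)).liftQ (antipodeAct k H X n) (Submodule.span_le.2 (by
    rintro _ ⟨h, v, rfl⟩
    simp [antipodeAct_diagonal]))

/-- In the coinvariants, `[c ⊗ w] = [c₍₁₎ ⊗ c₍₂₎ S(c₍₃₎) w] = [1 ⊗ S(c) w]`. -/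
theorem mk_cons (n : ℕ) (c : H) (w : tensorPow k H X n) :
    mk (n + 1) (cons c w) =
      mk (n + 1) (cons (1 : H) (diagonal n (HopfAlgebra.antipode k c) w)) := by
  let Φ : H ⊗[k] (H ⊗[k] H) →ₗ[k] tensorPow k H X (n + 1) :=
    TensorProduct.lift (LinearMap.mk₂ k (fun a t => cons a (diagonal n
      (LinearMap.mul' k H ((HopfAlgebra.antipode k (A := H)).lTensor H t)) w))
      (by intros; simp) (by intros; simp) (by intros; simp) (by intros; simp))
  have h1 : ∀ t : H ⊗[k] H, Φ ((Coalgebra.comul (R := k) (A := H)).lTensor H t) =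
      cons (TensorProduct.rid k H ((Coalgebra.counit (R := k) (A := H)).lTensor H t)) w := by
    intro t
    induction t using TensorProduct.induction_on with
    | zero => simp
    | add u v hu hv => simp only [map_add, LinearMap.add_apply, hu, hv]
    | tmul a b =>
      simp [Φ, HopfAlgebra.mul_antipode_lTensor_comul_apply, Algebra.algebraMap_eq_smul_one,
        diagonal_one]
  have h2 : ∀ t : H ⊗[k] H, mk (n + 1) (Φ (TensorProduct.assoc k H H H
      ((Coalgebra.comul (R := k) (A := H)).rTensor H t))) = mk (n + 1) (cons (1 : H) (diagonal n
        (HopfAlgebra.antipode k (TensorProduct.lid k H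
          ((Coalgebra.counit (R := k) (A := H)).rTensor H t))) w)) := by
    intro t
    induction t using TensorProduct.induction_on with
    | zero => simp
    | add u v hu hv => simp only [map_add, LinearMap.add_apply, hu, hv]
    | tmul a b =>
      have h3 : ∀ s : H ⊗[k] H, Φ (TensorProduct.assoc k H H H (s ⊗ₜ b)) =
          diagonalAux n 1 (diagonal n (HopfAlgebra.antipode k b) w) s := by
        intro s
        induction s using TensorProduct.induction_on with
        | zero => simp
        | add u v hu hv => simp only [map_add, TensorProduct.add_tmul, hu, hv]
        | tmul p q => simp [Φ, diagonal_mul]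
      rw [LinearMap.rTensor_tmul, h3, ← diagonal_cons, mk_diagonal, LinearMap.rTensor_tmul,
        TensorProduct.lid_tmul, map_smul, map_smul, LinearMap.smul_apply, map_smul, map_smul]
  have h4 := h2 (Coalgebra.comul (R := k) c)
  rw [Coalgebra.coassoc_apply, h1] at h4
  simpa using h4

variable (k H X) in
/-- The identification `w ↦ [1 ⊗ w]` of `H^{⊗ n} ⊗ X` with the coinvariants of
`H^{⊗ (n+1)} ⊗ X`. -/
def coinvariantsEquiv (n : ℕ) :
    tensorPow k H X n ≃ₗ[k] tensorPow k H X (n + 1) ⧸ relations k H X (n + 1) :=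
  LinearEquiv.ofLinearMap (mk (n + 1) ∘ₗ cons (1 : H)) (coinvariantsToCobar k H X n)
    (Submodule.linearMap_qext _ (tensorPow.hom_ext fun c w => by
      exact (congrArg (fun v => mk (n + 1) (cons (1 : H) v)) (antipodeAct_cons n c w)).trans
        (mk_cons n c w).symm))
    (LinearMap.ext fun w => by
      refine (antipodeAct_cons n 1 w).trans ?_
      rw [HopfAlgebra.antipode_one, diagonal_one]
      rfl)

variable [LeftComodule k H X]

/-- For `c₀ = 1` the last coface of the cocyclic module only applies the coaction of `X`. -/
theorem append_one (n : ℕ) (w : tensorPow k H X n) :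
    append n w (1 : H) = coface LeftComodule.coact n n w := by
  induction n with
  | zero =>
    induction w using tensorPow.induction_zero with
    | h x =>
      rw [append_base, coface_base, LinearMap.mulRight_one]
      exact congrArg one (LinearMap.congr_fun (LinearMap.rTensor_id X H) _)
  | succ n ih =>
    induction w using tensorPow.induction with
    | ha x y hx hy => simp only [map_add, LinearMap.add_apply, hx, hy]
    | hc h w => rw [append_cons, coface_cons_succ, ih]

theorem preδ_cons_one_zero (n : ℕ) (w : tensorPow k H X n) :
    preδ n 0 (cons (1 : H) w) = cons (1 : H) (cons (1 : H) w) := by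
  rw [preδ_of_le (Nat.zero_le n), coface_cons_zero, Bialgebra.comul_one,
    Algebra.TensorProduct.one_def, cons₂_tmul]

theorem preδ_cons_one_succ (n i : ℕ) (hi : i ≤ n) (w : tensorPow k H X n) :
    preδ n (i + 1) (cons (1 : H) w) = cons (1 : H) (coface LeftComodule.coact n i w) := by
  rcases hi.lt_or_eq with h | rfl
  · rw [preδ_of_le (by omega), coface_cons_succ]
  · rw [preδ_last, LinearMap.comp_apply, coface_cons_zero, Bialgebra.comul_one,
      Algebra.TensorProduct.one_def, cons₂_tmul, rotate_cons, append_cons, append_one]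

/-- The coface number `0` of `1 ⊗ w` is `1 ⊗ 1 ⊗ w`, the others are those of `w` shifted by one; this
shift is the source of the sign. -/
theorem sum_preδ_cons_one (n : ℕ) (w : tensorPow k H X n) :
    (∑ i ∈ Finset.range (n + 2), (-1 : ℤ) ^ i • preδ n i) (cons (1 : H) w) =
      -cons (1 : H) (cobarD k H X n w) := by
  have : ∀ i ∈ Finset.range (n + 1),
      ((-1 : ℤ) ^ (i + 1) • preδ (k := k) (H := H) (X := X) n (i + 1)) (cons (1 : H) w) =
        -cons (1 : H) (((-1 : ℤ) ^ i • coface LeftComodule.coact n i) w) := by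
    intro i hi
    rw [LinearMap.smul_apply, LinearMap.smul_apply,
      preδ_cons_one_succ n i (by simpa [Nat.lt_succ_iff] using hi), pow_succ, map_zsmul]
    simp
  rw [Finset.sum_range_succ', LinearMap.add_apply, LinearMap.sum_apply, Finset.sum_congr rfl this]
  simp only [pow_zero, one_smul, preδ_cons_one_zero, cobarD, sumCoface, LinearMap.add_apply,
    LinearMap.neg_apply, LinearMap.sum_apply, map_add, map_neg, map_sum, Finset.sum_neg_distrib]
  abel

variable [HasInvertibleAntipode k H]

theorem b_coinvariantsEquiv (hX : IsAYD k H X) (hs : IsStable k H X) (n : ℕ)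
    (w : tensorPow k H X n) :
    (hopfCyclicModule k H X hX hs).b n (coinvariantsEquiv k H X n w) =
      -coinvariantsEquiv k H X (n + 1) (cobarD k H X n w) := by
  have h1 : (hopfCyclicModule k H X hX hs).b n (mk (n + 1) (cons (1 : H) w)) = mk (n + 2)
      ((∑ i ∈ Finset.range (n + 2), (-1 : ℤ) ^ i • preδ n i) (cons (1 : H) w)) := by
    refine (LinearMap.sum_apply _ _ _).trans ?_
    rw [LinearMap.sum_apply, map_sum]
    refine Finset.sum_congr rfl fun i _ => ?_
    rw [LinearMap.smul_apply, map_zsmul]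
    rfl
  refine h1.trans ?_
  rw [sum_preδ_cons_one, map_neg]
  rfl

variable (k H X) in
/-- The cobar complex is isomorphic to the Hochschild complex of the Hopf-cyclic complex by
`w ↦ (-1)^n [1 ⊗ w]`. -/
def cobarIsoHochschild (hX : IsAYD k H X) (hs : IsStable k H X) :
    cobarComplex k H X ≅ (hopfCyclicModule k H X hX hs).hochschildComplex :=
  cochainComplexOfIso (fun n => ModuleCat.hom_ext (LinearMap.ext (cobarD_cobarD n)))
    (fun n => ModuleCat.hom_ext ((hopfCyclicModule k H X hX hs).b_comp_b n))
    (fun n => ((coinvariantsEquiv k H X n).trans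
      (LinearEquiv.smulOfUnit ((-1 : kˣ) ^ n))).toModuleIso)
    (fun n => ModuleCat.hom_ext (LinearMap.ext fun w => by
      refine (((hopfCyclicModule k H X hX hs).b n).map_smul (((-1 : kˣ) ^ n : kˣ) : k)
        (coinvariantsEquiv k H X n w)).trans ?_
      refine (congrArg ((((-1 : kˣ) ^ n : kˣ) : k) • ·) (b_coinvariantsEquiv hX hs n w)).trans ?_
      change (((-1 : kˣ) ^ n : kˣ) : k) • -coinvariantsEquiv k H X (n + 1) (cobarD k H X n w) =
        (((-1 : kˣ) ^ (n + 1) : kˣ) : k) • coinvariantsEquiv k H X (n + 1) (cobarD k H X n w)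
      generalize cobarD k H X n w = v
      simp [pow_succ]))

end HochschildIso

/-! ### Functoriality and exactness of tensor powers -/

section TensorPowMap

variable {k : Type u} [CommRing k] {H : Type u} [Ring H] [HopfAlgebra k H]
variable {M : Type u} [AddCommGroup M] [Module k M] {N : Type u} [AddCommGroup N] [Module k N]
variable {P : Type u} [AddCommGroup P] [Module k P]

namespace tensorPow

/-- The map `H^{⊗ n} ⊗ M → H^{⊗ n} ⊗ N` induced by a linear map `M → N`. -/
def map (f : M →ₗ[k] N) : (n : ℕ) → tensorPow k H M n →ₗ[k] tensorPow k H N n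
  | 0 => base.toLinearMap ∘ₗ f ∘ₗ base.symm.toLinearMap
  | n + 1 => (map f n).lTensor H

theorem map_base (f : M →ₗ[k] N) (m : M) :
    map f 0 (base m : tensorPow k H M 0) = base (f m) := rfl

protected theorem map_one (f : M →ₗ[k] N) (v : H ⊗[k] M) :
    map f 1 (one v) = one (f.lTensor H v) := rfl

theorem map_cons (f : M →ₗ[k] N) (n : ℕ) (h : H) (w : tensorPow k H M n) :
    map f (n + 1) (cons h w) = cons h (map f n w) := rfl

theorem map_cons₂ (f : M →ₗ[k] N) (n : ℕ) (s : H ⊗[k] H) (w : tensorPow k H M n) :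
    map f (n + 2) (cons₂ s w) = cons₂ s (map f n w) := by
  induction s using TensorProduct.induction_on with
  | zero => simp
  | add x y hx hy => simp only [map_add, LinearMap.add_apply, hx, hy]
  | tmul a b => simp [map_cons]

protected theorem map_id (n : ℕ) : map (H := H) (LinearMap.id : M →ₗ[k] M) n = LinearMap.id := by
  induction n with
  | zero => rfl
  | succ n ih => exact (congrArg (LinearMap.lTensor H) ih).trans (LinearMap.lTensor_id H _)

protected theorem map_comp (f : M →ₗ[k] N) (g : N →ₗ[k] P) (n : ℕ) :
    map (H := H) (g ∘ₗ f) n = map g n ∘ₗ map f n := by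
  induction n with
  | zero => rfl
  | succ n ih => exact (congrArg (LinearMap.lTensor H) ih).trans (LinearMap.lTensor_comp H _ _)

protected theorem map_zero (n : ℕ) : map (H := H) (0 : M →ₗ[k] N) n = 0 := by
  induction n with
  | zero => rfl
  | succ n ih => exact (congrArg (LinearMap.lTensor H) ih).trans (LinearMap.lTensor_zero H)

theorem map_injective [Module.Flat k H] {f : M →ₗ[k] N} (hf : Function.Injective f) (n : ℕ) :
    Function.Injective (map (H := H) f n) := by
  induction n with
  | zero => exact hf
  | succ n ih => exact Module.Flat.lTensor_preserves_injective_linearMap _ ih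

theorem map_surjective {f : M →ₗ[k] N} (hf : Function.Surjective f) (n : ℕ) :
    Function.Surjective (map (H := H) f n) := by
  induction n with
  | zero => exact hf
  | succ n ih => exact LinearMap.lTensor_surjective H ih

theorem map_exact [Module.Flat k H] {f : M →ₗ[k] N} {g : N →ₗ[k] P} (h : Function.Exact f g)
    (n : ℕ) : Function.Exact (map (H := H) f n) (map (H := H) g n) := by
  induction n with
  | zero => exact h
  | succ n ih => exact Module.Flat.lTensor_exact H ih

theorem sumCoface_map {ρ : M →ₗ[k] H ⊗[k] M} {σ : N →ₗ[k] H ⊗[k] N} {f : M →ₗ[k] N}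
    (hf : σ ∘ₗ f = f.lTensor H ∘ₗ ρ) (n : ℕ) (w : tensorPow k H M n) :
    sumCoface σ n (map f n w) = map f (n + 1) (sumCoface ρ n w) := by
  induction n with
  | zero =>
    induction w using tensorPow.induction_zero with
    | h m =>
      rw [map_base, sumCoface_base, sumCoface_base, tensorPow.map_one]
      exact congrArg one (LinearMap.congr_fun hf m)
  | succ n ih =>
    induction w using tensorPow.induction with
    | ha x y hx hy => simp only [map_add, hx, hy]
    | hc h w =>
      rw [map_cons, calculus.sum_coface_cons, calculus.sum_coface_cons, map_sub, map_cons₂,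
        map_cons, ih]

end tensorPow

end TensorPowMap

/-! ### The cobar complex as an exact functor -/

section CobarFunctor

open tensorPow

variable (k : Type u) [CommRing k] (H : Type u) [Ring H] [HopfAlgebra k H]

variable {k H} in
/-- The module underlying an object of `Comod` is a left comodule, which makes its cobar complex
available. -/
instance Comod.leftComodule (M : Comod k H) : LeftComodule k H M.A where
  coact := M.coaction
  coassoc := congrArg ModuleCat.Hom.hom M.coassoc
  counit_coact := congrArg ModuleCat.Hom.hom M.counit

variable {k H} in
theorem cobarD_map {M N : Comod k H} (f : M ⟶ N) (n : ℕ) (w : tensorPow k H M.A n) :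
    cobarD k H N.A n (tensorPow.map f.f.hom n w) =
      tensorPow.map f.f.hom (n + 1) (cobarD k H M.A n w) := by
  simp only [cobarD, LinearMap.add_apply, LinearMap.neg_apply, map_add, map_neg]
  rw [tensorPow.map_cons]
  exact congrArg (_ + ·) (sumCoface_map (Comod.coaction_map f) n w)

/-- The cobar complex, as a functor on left comodules. -/
def cobarFunctor : Comod k H ⥤ CochainComplex (ModuleCat.{u} k) ℕ where
  obj M := cobarComplex k H M.A
  map {M N} f :=
    { f := fun n => ModuleCat.ofHom (tensorPow.map f.f.hom n)
      comm' := by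
        rintro i _ rfl
        refine (congrArg (ModuleCat.ofHom (tensorPow.map f.f.hom i) ≫ ·) (cobarComplex_d i)).trans
          (Eq.trans ?_ (congrArg (· ≫ ModuleCat.ofHom (tensorPow.map f.f.hom (i + 1)))
            (cobarComplex_d i)).symm)
        exact ModuleCat.hom_ext (LinearMap.ext (cobarD_map f i)) }
  map_id M := HomologicalComplex.hom_ext _ _ fun n => ModuleCat.hom_ext (tensorPow.map_id n)
  map_comp f g := HomologicalComplex.hom_ext _ _ fun n =>
    ModuleCat.hom_ext (tensorPow.map_comp f.f.hom g.f.hom n)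

instance cobarFunctor.preservesZeroMorphisms : (cobarFunctor k H).PreservesZeroMorphisms where
  map_zero _ _ := HomologicalComplex.hom_ext _ _ fun n => ModuleCat.hom_ext (tensorPow.map_zero n)

variable {k H} in
theorem cobarFunctor_map_shortExact [Module.Flat k H] {S : ShortComplex (Comod k H)}
    (hS : S.ShortExact) : (S.map (cobarFunctor k H)).ShortExact := by
  have h := hS.map_of_exact (comoduleComonad k H).forget
  have hi := (ModuleCat.mono_iff_injective _).1 h.mono_f
  have he := (ShortComplex.ShortExact.moduleCat_exact_iff_function_exact _).1 h.exact
  have hs := (ModuleCat.epi_iff_surjective _).1 h.epi_g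
  refine HomologicalComplex.shortExact_of_degreewise_shortExact _ fun n =>
    { exact := (ShortComplex.ShortExact.moduleCat_exact_iff_function_exact _).2 (map_exact he n)
      mono_f := (ModuleCat.mono_iff_injective _).2 (map_injective hi n)
      epi_g := (ModuleCat.epi_iff_surjective _).2 (map_surjective hs n) }

end CobarFunctor

/-! ### The cotensor product as cohomology in degree zero -/

section Cotensor

open tensorPow HomologicalComplex

variable {k : Type u} [CommRing k] {H : Type u} [Ring H] [HopfAlgebra k H]

/-- Under `k ⊗ M ≃ M` the cotensor product `k □ M` becomes the submodule of those `m` with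
`ρ(m) = 1 ⊗ m`, the cocycles of degree `0`. -/
theorem mem_cotensor_iff (M : Comod k H) (z : k ⊗[k] M.A) :
    z ∈ cotensor k H k M ↔
      cobarD k H M.A 0 (base (TensorProduct.lid k M.A z)) = 0 := by
  obtain ⟨m, rfl⟩ := (TensorProduct.lid k M.A).symm.surjective z
  rw [LinearEquiv.apply_symm_apply, TensorProduct.lid_symm_apply]
  have h1 : cobarD k H M.A 0 (base m) = one (M.coaction m - 1 ⊗ₜ m) := by
    simp only [cobarD, LinearMap.add_apply, LinearMap.neg_apply]
    rw [sumCoface_base, map_sub, neg_add_eq_sub]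
    rfl
  have h2 : (1 : k) ⊗ₜ[k] m ∈ cotensor k H k M ↔
      (1 : k) ⊗ₜ[k] ((1 : H) ⊗ₜ[k] m) = (1 : k) ⊗ₜ[k] M.coaction m := Iff.rfl
  rw [h1, h2, LinearEquiv.map_eq_zero_iff, sub_eq_zero, eq_comm]
  exact ((TensorProduct.lid k (H ⊗[k] M.A)).symm.injective.eq_iff
    (a := M.coaction m) (b := 1 ⊗ₜ m))

/-- The inclusion of `k □ M` into the degree `0` part `M` of the cobar complex. -/
def cotensorι (M : Comod k H) :
    (cotensorFunctor k H k).obj M ⟶ ((cobarFunctor k H).obj M).X 0 :=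
  ModuleCat.ofHom (base.toLinearMap ∘ₗ (TensorProduct.lid k M.A).toLinearMap ∘ₗ
    (cotensor k H k M).subtype)

theorem cotensorι_d (M : Comod k H) :
    cotensorι M ≫ ((cobarFunctor k H).obj M).d 0 1 = 0 := by
  refine (congrArg (cotensorι M ≫ ·) (cobarComplex_d 0)).trans ?_
  exact ModuleCat.hom_ext (LinearMap.ext fun z => (mem_cotensor_iff M z.1).1 z.2)

theorem cotensorι_exact (M : Comod k H) : (ShortComplex.mk _ _ (cotensorι_d M)).Exact := by
  rw [ShortComplex.moduleCat_exact_iff]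
  intro x hx
  have hx' : cobarD k H M.A 0 x = 0 :=
    (congrArg (fun f => f.hom x) (cobarComplex_d (k := k) (H := H) (X := M.A) 0)).symm.trans hx
  obtain ⟨z, rfl⟩ := (TensorProduct.lid k M.A).surjective x
  exact ⟨⟨z, (mem_cotensor_iff M z).2 hx'⟩, rfl⟩

instance cotensorι_mono (M : Comod k H) : Mono (cotensorι M) :=
  (ModuleCat.mono_iff_injective _).2 fun _ _ h =>
    Subtype.ext ((TensorProduct.lid k M.A).injective h)

theorem cotensorι_naturality {M N : Comod k H} (f : M ⟶ N) :
    (cotensorFunctor k H k).map f ≫ cotensorι N =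
      cotensorι M ≫ ((cobarFunctor k H).map f).f 0 := by
  have h : ∀ z : k ⊗[k] M.A, TensorProduct.lid k N.A (f.f.hom.lTensor k z) =
      f.f.hom (TensorProduct.lid k M.A z) := by
    intro z
    induction z using TensorProduct.induction_on with
    | zero => simp
    | tmul r m => simp
    | add x y hx hy => simp only [map_add, hx, hy]
  exact ModuleCat.hom_ext (LinearMap.ext fun z => h z.1)

variable (k H) in
/-- The cotensor product `k □ M` is the cohomology in degree `0` of the cobar complex of `M`. -/
def cotensorIsoHomologyZero : cotensorFunctor k H k ≅
    cobarFunctor k H ⋙ homologyFunctor (ModuleCat.{u} k) (ComplexShape.up ℕ) 0 :=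
  have : ∀ M : Comod k H, Mono (ShortComplex.mk _ _ (cotensorι_d M)).f := fun M =>
    cotensorι_mono M
  NatIso.ofComponents
    (fun M => (cotensorι_exact M).fIsKernel.conePointUniqueUpToIso
      (((cobarFunctor k H).obj M).cyclesIsKernel 0 1 (by simp)) ≪≫
        ((cobarFunctor k H).obj M).isoHomologyπ₀)
    (fun {M N} f => by
      have h : ∀ M : Comod k H, ((cotensorι_exact M).fIsKernel.conePointUniqueUpToIso
          (((cobarFunctor k H).obj M).cyclesIsKernel 0 1 (by simp))).hom ≫
            ((cobarFunctor k H).obj M).iCycles 0 = cotensorι M := fun M =>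
        IsLimit.conePointUniqueUpToIso_hom_comp _ _ WalkingParallelPair.zero
      have h' : (cotensorFunctor k H k).map f ≫
          ((cotensorι_exact N).fIsKernel.conePointUniqueUpToIso
            (((cobarFunctor k H).obj N).cyclesIsKernel 0 1 (by simp))).hom =
          ((cotensorι_exact M).fIsKernel.conePointUniqueUpToIso
            (((cobarFunctor k H).obj M).cyclesIsKernel 0 1 (by simp))).hom ≫
            cyclesMap ((cobarFunctor k H).map f) 0 := by
        rw [← cancel_mono (((cobarFunctor k H).obj N).iCycles 0), Category.assoc, Category.assoc,
          h, cyclesMap_i, ← Category.assoc, h, cotensorι_naturality]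
      refine (Category.assoc _ _ _).symm.trans ((congrArg (· ≫ _) h').trans ?_)
      refine (Category.assoc _ _ _).trans (Eq.trans ?_ (Category.assoc _ _ _).symm)
      exact congrArg (_ ≫ ·) (homologyπ_naturality ((cobarFunctor k H).map f) 0).symm)

end Cotensor

/-! ### Acyclicity on cofree and injective comodules -/

section Cofree

open tensorPow

variable {k : Type u} [CommRing k] {H : Type u} [Ring H] [HopfAlgebra k H]

section

variable {V : Type u} [AddCommGroup V] [Module k V]

/-- The contracting homotopy `h₀ ⊗ ⋯ ⊗ hₙ ⊗ (a ⊗ v) ↦ ε(a) h₀ ⊗ ⋯ ⊗ hₙ₋₁ ⊗ (hₙ ⊗ v)` of the cobar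
complex of the cofree comodule `H ⊗ V`. -/
def contract : (n : ℕ) → tensorPow k H (H ⊗[k] V) (n + 1) →ₗ[k] tensorPow k H (H ⊗[k] V) n
  | 0 => base.toLinearMap ∘ₗ ((TensorProduct.lid k V).toLinearMap ∘ₗ
      (Coalgebra.counit (R := k) (A := H)).rTensor V).lTensor H ∘ₗ one.symm.toLinearMap
  | n + 1 => (contract n).lTensor H

theorem contract_zero (h a : H) (v : V) :
    contract 0 (cons h (base (a ⊗ₜ[k] v))) = base (Coalgebra.counit (R := k) a • h ⊗ₜ[k] v) := by
  refine Eq.trans (b := base (h ⊗ₜ[k] (Coalgebra.counit (R := k) a • v))) rfl ?_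
  rw [TensorProduct.tmul_smul]

theorem contract_cons (n : ℕ) (h : H) (w : tensorPow k H (H ⊗[k] V) (n + 1)) :
    contract (n + 1) (cons h w) = cons h (contract n w) := rfl

theorem contract_cons₂ (n : ℕ) (s : H ⊗[k] H) (w : tensorPow k H (H ⊗[k] V) (n + 1)) :
    contract (n + 2) (cons₂ s w) = cons₂ s (contract n w) := by
  induction s using TensorProduct.induction_on with
  | zero => simp
  | add x y hx hy => simp only [map_add, LinearMap.add_apply, hx, hy]
  | tmul a b => simp [contract_cons]

variable (k H V) in
/-- The coaction `a ⊗ v ↦ a₍₁₎ ⊗ (a₍₂₎ ⊗ v)` of the cofree comodule `H ⊗ V`. -/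
abbrev cofreeCoact : H ⊗[k] V →ₗ[k] H ⊗[k] (H ⊗[k] V) :=
  (TensorProduct.assoc k H H V).toLinearMap ∘ₗ (Coalgebra.comul (R := k) (A := H)).rTensor V

/-- The map `contract` commutes with the coface number `j` for `j ≤ n`, and it cancels the coface
number `n + 1`, which is the coaction. -/
theorem contract_sumCoface (n : ℕ) (w : tensorPow k H (H ⊗[k] V) (n + 1)) :
    contract (n + 1) (sumCoface (cofreeCoact k H V) (n + 1) w) =
      sumCoface (cofreeCoact k H V) n (contract n w) + (-1 : ℤ) ^ (n + 1) • w := by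
  induction n with
  | zero =>
    induction w using tensorPow.induction with
    | ha x y hx hy =>
      simp only [map_add, smul_add, hx, hy]
      abel
    | hc h w =>
    induction w using tensorPow.induction_zero with
    | h m =>
    induction m using TensorProduct.induction_on with
    | zero => simp
    | add x y hx hy =>
      simp only [map_add, smul_add] at hx hy ⊢
      rw [hx, hy]
      abel
    | tmul a v =>
      rw [calculus.sum_coface_cons, map_sub, contract_zero, map_smul, map_smul, sumCoface_base,
        contract_cons, sumCoface_base]
      have h1 : ∀ s : H ⊗[k] H, contract 1 (cons₂ s (base (a ⊗ₜ[k] v))) =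
          Coalgebra.counit (R := k) a • one (TensorProduct.assoc k H H V (s ⊗ₜ v)) := by
        intro s
        induction s using TensorProduct.induction_on with
        | zero => simp
        | add x y hx hy =>
          simp only [map_add, LinearMap.add_apply, TensorProduct.add_tmul, smul_add, hx, hy]
        | tmul p q => simp [contract_cons, contract_zero]
      have h2 : contract 0 (one (cofreeCoact k H V (a ⊗ₜ[k] v))) = base (a ⊗ₜ[k] v) := by
        have key := Coalgebra.lTensor_counit_comul (R := k) a
        have : ∀ s : H ⊗[k] H, contract 0 (one (TensorProduct.assoc k H H V (s ⊗ₜ v))) =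
            base ((TensorProduct.rid k H
              ((Coalgebra.counit (R := k) (A := H)).lTensor H s)) ⊗ₜ[k] v) := by
          intro s
          induction s using TensorProduct.induction_on with
          | zero => simp
          | add x y hx hy => simp only [map_add, TensorProduct.add_tmul, hx, hy]
          | tmul p q => simp [contract_zero, TensorProduct.smul_tmul']
        refine (this _).trans ?_
        rw [key, TensorProduct.rid_tmul, one_smul]
      have h3 : (-1 : ℤ) ^ (0 + 1) = -1 := rfl
      rw [h1, h2, h3, neg_smul, one_smul, sub_eq_add_neg]
      rfl
  | succ n ih =>
    induction w using tensorPow.induction with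
    | ha x y hx hy =>
      simp only [map_add, smul_add, hx, hy]
      abel
    | hc h w =>
      have hc := calculus.sum_coface_cons (cofreeCoact k H V) n h (contract n w)
      rw [calculus.sum_coface_cons, map_sub, contract_cons₂, contract_cons, ih, contract_cons, hc,
        map_add, map_zsmul, pow_succ (-1 : ℤ) (n + 1)]
      simp only [mul_neg, mul_one, neg_smul]
      abel

theorem exists_eq_of_cofree_cocycle (n : ℕ) (w : tensorPow k H (H ⊗[k] V) (n + 1))
    (hw : -cons (1 : H) w + sumCoface (cofreeCoact k H V) (n + 1) w = 0) :
    ∃ v : tensorPow k H (H ⊗[k] V) n, -cons (1 : H) v + sumCoface (cofreeCoact k H V) n v = w := by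
  refine ⟨(-1 : ℤ) ^ n • contract n w, ?_⟩
  have key := congrArg (contract (n + 1)) hw
  rw [map_add, map_neg, contract_cons, contract_sumCoface, map_zero, ← add_assoc, pow_succ,
    mul_neg_one, neg_smul, ← sub_eq_add_neg, sub_eq_zero] at key
  rw [map_zsmul, map_zsmul, ← smul_neg, ← smul_add, key, smul_smul, ← mul_pow]
  simp

end

theorem isZero_homology_cofree (V : ModuleCat.{u} k) (n : ℕ) :
    IsZero (((cobarFunctor k H).obj ((comoduleComonad k H).cofree.obj V)).homology (n + 1)) := by
  rw [← HomologicalComplex.exactAt_iff_isZero_homology,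
    HomologicalComplex.exactAt_iff' _ n (n + 1) (n + 2) (by simp) (by simp),
    ShortComplex.moduleCat_exact_iff]
  intro w hw
  let M : Comod k H := (comoduleComonad k H).cofree.obj V
  obtain ⟨v, hv⟩ := exists_eq_of_cofree_cocycle (k := k) (H := H) (V := V) n w
    ((congrArg (fun f => f.hom w) (cobarComplex_d (k := k) (H := H) (X := M.A)
      (n + 1))).symm.trans hw)
  exact ⟨v, (congrArg (fun f => f.hom v) (cobarComplex_d (k := k) (H := H) (X := M.A) n)).trans hv⟩

/-- The coaction embeds an injective comodule as a retract of a cofree one. -/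
theorem isZero_homology_of_injective [Module.Flat k H] (I : Comod k H) [Injective I] (n : ℕ) :
    IsZero (((cobarFunctor k H).obj I).homology (n + 1)) := by
  let u : I ⟶ (comoduleComonad k H).cofree.obj I.A :=
    { f := I.a, h := I.coassoc.symm }
  have hu : Mono u := by
    -- The counit splits the coaction as a map of `k`-modules.
    have h1 : u.f ≫ (comoduleComonad k H).ε.app I.A = 𝟙 I.A := I.counit
    have h2 : Mono ((comoduleComonad k H).forget.map u) := by
      have : Mono (u.f ≫ (comoduleComonad k H).ε.app I.A) := by
        rw [h1]
        exact inferInstanceAs (Mono (𝟙 I.A))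
      exact mono_of_mono u.f ((comoduleComonad k H).ε.app I.A)
    exact (comoduleComonad k H).forget.mono_of_mono_map h2
  -- The identity of `I` factors through a cofree comodule.
  have hr : u ≫ Injective.factorThru (𝟙 I) u = 𝟙 I := Injective.comp_factorThru _ _
  let T := cobarFunctor k H ⋙
    HomologicalComplex.homologyFunctor (ModuleCat.{u} k) (ComplexShape.up ℕ) (n + 1)
  have h0 : IsZero (T.obj ((comoduleComonad k H).cofree.obj I.A)) := isZero_homology_cofree I.A n
  change IsZero (T.obj I)
  rw [IsZero.iff_id_eq_zero, ← T.map_id, ← hr, T.map_comp, h0.eq_of_tgt (T.map u) 0, zero_comp]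

end Cofree

end

theorem mainTheorem6 (k : Type u) [CommRing k] (H : Type u) [Ring H] [HopfAlgebra k H]
    [Module.Flat k H] [HasInvertibleAntipode k H]
    (X : Type u) [AddCommGroup X] [Module k X] [Module H X] [IsScalarTower k H X]
    [LeftComodule k H X] (hX : IsAYD k H X) :
    (∀ n : ℕ, Nonempty ((calculusComplex k H X hX).homology n ≅ Cotor k H k n X)) ∧
    (∀ hs : IsStable k H X,
      Nonempty (calculusComplex k H X hX ≅ (hopfCyclicModule k H X hX hs).hochschildComplex)) := by
  refine ⟨fun n => ?_, fun hs =>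
    ⟨(cobarIsoCalculus k H X hX).symm ≪≫ cobarIsoHochschild k H X hX hs⟩⟩
  obtain ⟨e⟩ := nonempty_rightDerived_iso (cobarFunctor k H)
    (fun _ => cobarFunctor_map_shortExact) (fun I _ => isZero_homology_of_injective I)
    (cotensorFunctor k H k) (cotensorIsoHomologyZero k H) (Comod.of k H X) n
  exact ⟨(HomologicalComplex.homologyFunctor _ _ n).mapIso (cobarIsoCalculus k H X hX).symm ≪≫
    e.symm⟩
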